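/- Let $n\ge 2$, $\zeta=e^{2\pi i/n}$, $G=\mathbb{C}^*$, and let $G$ act on $X=\mathbb{C}^2\setminus\{0\}$ by $\lambda\cdot(z_1,z_2)=(\lambda z_1,\lambda^n z_2)$, so that $[X/G]=\mathbb{P}(1,n)$. Let $I_GX=\{(g,x)\in G\times X: gx=x\}$ be the inertia space, with the action $h\cdot(g,x)=(hgh^{-1},hx)$; it is the disjoint union of the sectors $X^m=\{(\zeta^m,x):\zeta^mx=x\}$, $m=0,\dots,n-1$. Let $K=K_G(I_GX)\otimes\mathbb{C}$, where $K_G(I_GX)$ is the Grothendieck ring of $G$-equivariant complex vector bundles on $I_GX$ (with the tensor product). Let $1_m\in K$ be the class of the bundle that is the trivial line bundle on $X^m$ and zero on the other sectors, and let $x_m\in K$ be the class of the bundle that is the line bundle of the standard character $\lambda\mapsto\lambda$ on $X^m$ and zero on the other sectors. The virtual Adams operations on $K$ are, for $k\ge 1$, $$\widetilde\psi^k(F)=\psi^k(F)\cdot\theta^k(N^*),$$ where $\psi^k$ is the ($\mathbb{C}$-linearly extended) usual Adams operation of equivariant K-theory, $N$ is the normal bundle of the projection $I_GX\to X$, and $\theta^k$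 is the Bott class, multiplicative with $\theta^k(L)=1+L+\dots+L^{k-1}$ for line bundles $L$. For $l=0,\dots,n-1$ let $\mathcal{K}_l$ be the localization of $K$, as an algebra over $R(G)\otimes\mathbb{C}=\mathbb{C}[x^{\pm1}]$, at the maximal ideal $\langle x-\zeta^l\rangle$, let $\mathcal{K}=\bigoplus_{l=0}^{n-1}\mathcal{K}_l$, and let $\Gamma:K\to\mathcal{K}$ be given by the localization maps. Let $1_{ml},x_{ml}\in\mathcal{K}_l\subseteq\mathcal{K}$ be the images of $1_m$ and $x_m$ in $\mathcal{K}_l$. Then $\Gamma$ is bijective. Let $k\ge1$ and $d=\gcd(k,n)$, and write $\widetilde\psi^k$ also for the operation $\Gamma\circ\widetilde\psi^k\circ\Gamma^{-1}$ on $\mathcal{K}$, which is $\mathbb{C}$-linear. For $0\le l\le n-1$, the congruence $ky\equiv l \bmod n$ has exactly $d$ solutions $y=s_1,\dots,s_d$ in $\{0,\dots,n-1\}$ if $d\mid l$, and none if $d\nmid l$; for $l=0$ number them so that $s_1=0$. For $m,l\in\{0,\dots,n-1\}$, \begin{align*} \widetilde\psi^k(1_{0l})&=\sum_{i=1}^d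 1_{0s_i} &&\text{if } l\ne0,\ d\mid l,\\ \widetilde\psi^k(1_{0l})&=0 &&\text{if } l\ne0,\ d\nmid l,\\ \widetilde\psi^k(1_{ml})&=\sum_{i=1}^d\frac{\zeta^{-l}-1}{\zeta^{-s_i}-1}\,1_{ms_i} &&\text{if } m\ne0,\ l\neq0,\ d\mid l,\\ \widetilde\psi^k(1_{ml})&=0 &&\text{if } m\ne0,\ l\ne0,\ d\nmid l,\\ \widetilde\psi^k(1_{m0})&=k\,1_{m0} &&\text{if } m\ne0,\\ \widetilde\psi^k(1_{00})&=\sum_{i=1}^d 1_{0s_i} &&\text{(solutions for } l=0),\\ \widetilde\psi^k(x_{00})&=k\,x_{00}-(k-1)\,1_{00}+\sum_{i=2}^d1_{0s_i} &&\text{(solutions for } l=0). \end{align*} -/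

import Mathlib

set_option linter.unusedVariables false

open scoped TensorProduct

/-! # Equivariant topological K-theory and the weighted projective line

Contents: `G`-equivariant complex vector bundles, their Grothendieck ring, exterior power and Adams
operations; the inertia space of the weighted projective line, its virtual Adams operations, and
the localizations of its K-theory at the maximal ideals of the representation ring. -/

noncomputable section

namespace VirtualKTheory

/-! ## Continuity of maps into finite-dimensional vector spaces -/

/-- `f` is continuous on `S`, for the canonical topology of the (finite-dimensional) complex vector
space `V`: every linear coordinate of `f` is continuous. -/
def WCts {T V : Type} [TopologicalSpace T] [AddCommGroup V] [Module ℂ V] (f : T → V)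
    (S : Set T) : Prop :=
  ∀ ℓ : Module.Dual ℂ V, ContinuousOn (fun t => ℓ (f t)) S

namespace WCts
variable {T V W : Type} [TopologicalSpace T] [AddCommGroup V] [Module ℂ V]
  [AddCommGroup W] [Module ℂ W] {S : Set T}

theorem map {f : T → V} (hf : WCts f S) (L : V →ₗ[ℂ] W) : WCts (fun t => L (f t)) S :=
  fun ℓ => hf (ℓ ∘ₗ L)

theorem mono {f : T → V} {S' : Set T} (hf : WCts f S) (h : S' ⊆ S) : WCts f S' :=
  fun ℓ => (hf ℓ).mono h

theorem congr {f f' : T → V} (hf : WCts f S) (h : ∀ t ∈ S, f' t = f t) : WCts f' S :=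
  fun ℓ => (hf ℓ).congr fun t ht => by simp only [h t ht]

theorem const (v : V) : WCts (fun _ : T => v) S := fun _ => continuousOn_const

theorem comp {T' : Type} [TopologicalSpace T'] {f : T → V} (hf : WCts f S) {u : T' → T}
    {S' : Set T'} (hu : ContinuousOn u S') (h : Set.MapsTo u S' S) :
    WCts (fun t => f (u t)) S' := fun ℓ => (hf ℓ).comp hu h

theorem add {f f' : T → V} (hf : WCts f S) (hf' : WCts f' S) :
    WCts (fun t => f t + f' t) S := fun ℓ => by
  simp only [map_add]; exact (hf ℓ).add (hf' ℓ)

theorem sum {ι : Type} (s : Finset ι) {f : ι → T → V} (hf : ∀ i ∈ s, WCts (f i) S) :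
    WCts (fun t => ∑ i ∈ s, f i t) S := fun ℓ => by
  simp only [map_sum]; exact continuousOn_finsetSum s fun i hi => hf i hi ℓ

theorem smul {c : T → ℂ} (hc : ContinuousOn c S) {f : T → V} (hf : WCts f S) :
    WCts (fun t => c t • f t) S := fun ℓ => by
  simp only [map_smul, smul_eq_mul]; exact hc.mul (hf ℓ)

theorem apply [FiniteDimensional ℂ V] {A : T → V →ₗ[ℂ] W} (hA : ∀ v, WCts (fun t => A t v) S)
    {f : T → V} (hf : WCts f S) : WCts (fun t => A t (f t)) S := by
  let b := Module.finBasis ℂ V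
  refine (WCts.sum Finset.univ (f := fun i t => b.coord i (f t) • A t (b i))
    fun i _ => WCts.smul (hf _) (hA _)).congr fun t _ => ?_
  conv_lhs => rw [← b.sum_repr (f t), map_sum]
  simp

theorem prodMk {f : T → V} {f' : T → W} (hf : WCts f S) (hf' : WCts f' S) :
    WCts (fun t => (f t, f' t)) S := by
  refine ((hf.map (LinearMap.inl ℂ V W)).add (hf'.map (LinearMap.inr ℂ V W))).congr
    fun t _ => by simp

theorem pi {ι : Type} [Fintype ι] [DecidableEq ι] {U : ι → Type} [∀ i, AddCommGroup (U i)]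
    [∀ i, Module ℂ (U i)] {f : T → ∀ i, U i} (hf : ∀ i, WCts (fun t => f t i) S) :
    WCts f S := by
  refine (WCts.sum Finset.univ (f := fun i t => LinearMap.single ℂ U i (f t i))
    fun i _ => (hf i).map _).congr fun t _ => ?_
  exact (LinearMap.sum_single_apply U (f t)).symm

theorem tmul [FiniteDimensional ℂ V] {f : T → V} {f' : T → W} (hf : WCts f S)
    (hf' : WCts f' S) : WCts (fun t => f t ⊗ₜ[ℂ] f' t) S :=
  WCts.apply (A := fun t => (TensorProduct.mk ℂ V W).flip (f' t))
    (fun v => hf'.map (TensorProduct.mk ℂ V W v)) hf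

theorem multilinear [FiniteDimensional ℂ V] {k : ℕ} (M : MultilinearMap ℂ (fun _ : Fin k => V) W)
    {f : Fin k → T → V} (hf : ∀ i, WCts (f i) S) : WCts (fun t => M fun i => f i t) S := by
  classical
  let b := Module.finBasis ℂ V
  refine (WCts.sum Finset.univ (f := fun (r : Fin k → Fin (Module.finrank ℂ V)) t =>
    (∏ i, b.coord (r i) (f i t)) • M fun i => b (r i)) fun r _ =>
      WCts.smul (continuousOn_finsetProd _ fun i _ => hf i _) (WCts.const _)).congr fun t _ => ?_
  have h : (fun i => f i t) = fun i => ∑ j, b.coord j (f i t) • b j := by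
    funext i; exact (b.sum_repr (f i t)).symm
  rw [h, M.map_sum]
  exact Finset.sum_congr rfl fun r _ => M.map_smul_univ _ _

end WCts

/-! ## Exterior powers of a direct sum -/

section ext
variable (V W : Type) [AddCommGroup V] [Module ℂ V] [AddCommGroup W] [Module ℂ W]
open exteriorPower

/-- The wedge product `⋀ⁱ V ⊗ ⋀ʲ W → ⋀ᵏ (V × W)`, for `i + j = k`. -/
def wedgeMap (i j k : ℕ) (h : i + j = k) :
    (⋀[ℂ]^i V) ⊗[ℂ] (⋀[ℂ]^j W) →ₗ[ℂ] ⋀[ℂ]^k (V × W) :=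
  TensorProduct.lift <| LinearMap.mk₂ ℂ
    (fun a b => ⟨(exteriorPower.map i (LinearMap.inl ℂ V W) a : ExteriorAlgebra ℂ (V × W)) *
      (exteriorPower.map j (LinearMap.inr ℂ V W) b : ExteriorAlgebra ℂ (V × W)), by
        subst h; rw [ExteriorAlgebra.exteriorPower, pow_add]; exact Submodule.mul_mem_mul (Subtype.prop _) (Subtype.prop _)⟩)
    (by intros; ext; simp [add_mul]) (by intros; ext; simp)
    (by intros; ext; simp [mul_add]) (by intros; ext; simp)

theorem coe_map_exteriorPower {V W : Type} [AddCommGroup V] [Module ℂ V] [AddCommGroup W]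
    [Module ℂ W] (k : ℕ) (f : V →ₗ[ℂ] W) (a : ⋀[ℂ]^k V) :
    (exteriorPower.map k f a : ExteriorAlgebra ℂ W) = ExteriorAlgebra.map f a := by
  have : (⋀[ℂ]^k W).subtype ∘ₗ exteriorPower.map k f =
      (ExteriorAlgebra.map f).toLinearMap ∘ₗ (⋀[ℂ]^k V).subtype := by
    apply exteriorPower.linearMap_ext
    ext m
    simp [ExteriorAlgebra.map_apply_ιMulti]
  exact LinearMap.congr_fun this a

theorem wedgeMap_coe (i j k : ℕ) (h : i + j = k) (a : ⋀[ℂ]^i V) (b : ⋀[ℂ]^j W) :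
    (wedgeMap V W i j k h (a ⊗ₜ b) : ExteriorAlgebra ℂ (V × W)) =
      ExteriorAlgebra.map (LinearMap.inl ℂ V W) a *
        ExteriorAlgebra.map (LinearMap.inr ℂ V W) b := by
  rw [← coe_map_exteriorPower, ← coe_map_exteriorPower]; rfl

/-- The sum of the wedge products; it is the isomorphism `⨁ᵢ ⋀ⁱ V ⊗ ⋀ᵏ⁻ⁱ W ≅ ⋀ᵏ (V × W)`. -/
def wedgeSum (k : ℕ) :
    (∀ i : Fin (k + 1), (⋀[ℂ]^(i : ℕ) V) ⊗[ℂ] (⋀[ℂ]^(k - i) W)) →ₗ[ℂ] ⋀[ℂ]^k (V × W) :=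
  ∑ i : Fin (k + 1), wedgeMap V W i (k - i) k (by omega) ∘ₗ LinearMap.proj i

theorem wedgeSum_natural {V W V' W' : Type} [AddCommGroup V] [Module ℂ V] [AddCommGroup W]
    [Module ℂ W] [AddCommGroup V'] [Module ℂ V'] [AddCommGroup W'] [Module ℂ W'] (k : ℕ)
    (f : V →ₗ[ℂ] V') (g : W →ₗ[ℂ] W')
    (x : ∀ i : Fin (k + 1), (⋀[ℂ]^(i : ℕ) V) ⊗[ℂ] (⋀[ℂ]^(k - i) W)) :
    wedgeSum V' W' k (fun i => TensorProduct.map (exteriorPower.map _ f)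
      (exteriorPower.map _ g) (x i)) = exteriorPower.map k (f.prodMap g) (wedgeSum V W k x) := by
  simp only [wedgeSum, LinearMap.sum_apply, map_sum]
  refine Finset.sum_congr rfl fun i _ => ?_
  simp only [LinearMap.comp_apply, LinearMap.proj_apply]
  induction x i with
  | zero => simp
  | add a b ha hb => simp only [map_add, ha, hb]
  | tmul a b =>
    ext
    rw [TensorProduct.map_tmul, wedgeMap_coe, coe_map_exteriorPower, coe_map_exteriorPower,
      coe_map_exteriorPower, wedgeMap_coe, map_mul]
    simp only [← AlgHom.comp_apply, ExteriorAlgebra.map_comp_map]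
    congr 3 <;> ext <;> simp

theorem wedgeSum_bijective [FiniteDimensional ℂ V] [FiniteDimensional ℂ W] (k : ℕ) :
    Function.Bijective (wedgeSum V W k) := by
  have hd : Module.finrank ℂ (∀ i : Fin (k + 1), (⋀[ℂ]^(i : ℕ) V) ⊗[ℂ] (⋀[ℂ]^(k - i) W)) =
      Module.finrank ℂ (⋀[ℂ]^k (V × W)) := by
    rw [Module.finrank_pi_fintype]
    simp only [Module.finrank_tensorProduct, exteriorPower.finrank_eq, Module.finrank_prod]
    rw [Nat.add_choose_eq, Finset.Nat.sum_antidiagonal_eq_sum_range_succ_mk, Finset.sum_range]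
  have hs : Function.Surjective (wedgeSum V W k) := by
    set A : Submodule ℂ (ExteriorAlgebra ℂ (V × W)) :=
      LinearMap.range (ExteriorAlgebra.ι ℂ ∘ₗ LinearMap.inl ℂ V W) with hA
    set B : Submodule ℂ (ExteriorAlgebra ℂ (V × W)) :=
      LinearMap.range (ExteriorAlgebra.ι ℂ ∘ₗ LinearMap.inr ℂ V W) with hB
    have hBA : B * A ≤ A * B := by
      rw [Submodule.mul_le]
      rintro _ ⟨w, rfl⟩ _ ⟨v, rfl⟩
      have := ExteriorAlgebra.ι_add_mul_swap (R := ℂ) (LinearMap.inr ℂ V W w) (LinearMap.inl ℂ V W v)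
      rw [add_eq_zero_iff_eq_neg] at this
      simp only [LinearMap.comp_apply]
      rw [this]
      exact neg_mem (Submodule.mul_mem_mul ⟨v, rfl⟩ ⟨w, rfl⟩)
    have hBAi : ∀ i, B * A ^ i ≤ A ^ i * B := by
      intro i
      induction i with
      | zero => simp
      | succ i ih =>
        calc B * A ^ (i + 1) = B * A ^ i * A := by rw [pow_succ, mul_assoc]
          _ ≤ A ^ i * B * A := by gcongr
          _ = A ^ i * (B * A) := by rw [mul_assoc]
          _ ≤ A ^ i * (A * B) := by gcongr
          _ = A ^ (i + 1) * B := by rw [pow_succ, mul_assoc]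
    have hAB : LinearMap.range (ExteriorAlgebra.ι ℂ (M := V × W)) ≤ A ⊔ B := by
      rintro _ ⟨⟨v, w⟩, rfl⟩
      have : ((v, w) : V × W) = LinearMap.inl ℂ V W v + LinearMap.inr ℂ V W w := by simp
      rw [this, map_add]
      exact Submodule.add_mem_sup ⟨v, rfl⟩ ⟨w, rfl⟩
    have hpow : ∀ k, (LinearMap.range (ExteriorAlgebra.ι ℂ (M := V × W))) ^ k ≤
        ⨆ p ∈ Finset.HasAntidiagonal.antidiagonal k, A ^ p.1 * B ^ p.2 := by
      intro k
      induction k with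
      | zero => simp
      | succ k ih =>
        rw [pow_succ']
        refine (mul_le_mul' hAB ih).trans ?_
        rw [Submodule.sup_mul]
        simp only [Submodule.mul_iSup]
        refine sup_le (iSup₂_le fun p hp => ?_) (iSup₂_le fun p hp => ?_)
        · refine le_trans ?_ (le_iSup₂_of_le (p.1 + 1, p.2) ?_ le_rfl)
          · rw [← mul_assoc, ← pow_succ']
          · simp at hp ⊢; omega
        · refine le_trans ?_ (le_iSup₂_of_le (p.1, p.2 + 1) ?_ le_rfl)
          · rw [← mul_assoc, pow_succ', ← mul_assoc]
            exact mul_le_mul' (hBAi _) le_rfl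
          · simp at hp ⊢; omega
    have hAi : ∀ i, A ^ i ≤ (⋀[ℂ]^i V).map (ExteriorAlgebra.map (LinearMap.inl ℂ V W)).toLinearMap := by
      intro i
      rw [ExteriorAlgebra.exteriorPower, Submodule.map_pow]
      refine pow_le_pow_left' ?_ i
      rintro _ ⟨v, rfl⟩
      exact ⟨_, ⟨v, rfl⟩, by simp⟩
    have hBi : ∀ i, B ^ i ≤ (⋀[ℂ]^i W).map (ExteriorAlgebra.map (LinearMap.inr ℂ V W)).toLinearMap := by
      intro i
      rw [ExteriorAlgebra.exteriorPower, Submodule.map_pow]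
      refine pow_le_pow_left' ?_ i
      rintro _ ⟨v, rfl⟩
      exact ⟨_, ⟨v, rfl⟩, by simp⟩
    have key : ⋀[ℂ]^k (V × W) ≤ (LinearMap.range (wedgeSum V W k)).map (⋀[ℂ]^k (V × W)).subtype := by
      refine (hpow k).trans (iSup₂_le fun p hp => ?_)
      refine (mul_le_mul' (hAi _) (hBi _)).trans ?_
      rw [Submodule.mul_le]
      rintro _ ⟨a, ha, rfl⟩ _ ⟨b, hb, rfl⟩
      obtain ⟨i, j⟩ := p
      have hp : i + j = k := Finset.HasAntidiagonal.mem_antidiagonal.1 hp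
      obtain rfl : j = k - i := by omega
      refine ⟨_, ⟨Pi.single (⟨i, by omega⟩ : Fin (k + 1)) ((⟨a, ha⟩ : ⋀[ℂ]^i V) ⊗ₜ[ℂ] (⟨b, hb⟩ : ⋀[ℂ]^(k - i) W)), rfl⟩, ?_⟩
      simp only [wedgeSum, LinearMap.sum_apply, LinearMap.comp_apply, LinearMap.proj_apply]
      rw [Finset.sum_eq_single (⟨i, by omega⟩ : Fin (k + 1))]
      · rw [Pi.single_eq_same]
        exact wedgeMap_coe V W i (k - i) k hp ⟨a, ha⟩ ⟨b, hb⟩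
      · intro l _ hl
        rw [Pi.single_eq_of_ne hl, map_zero]
      · simp
    rintro ⟨x, hx⟩
    obtain ⟨_, ⟨y, rfl⟩, hy⟩ := key hx
    exact ⟨y, Subtype.ext hy⟩
  refine ⟨?_, hs⟩
  have := (LinearMap.injective_iff_surjective_of_finrank_eq_finrank (K := ℂ)
    (V := ∀ i : Fin (k + 1), (⋀[ℂ]^(i : ℕ) V) ⊗[ℂ] (⋀[ℂ]^(k - i) W)) (V₂ := ⋀[ℂ]^k (V × W)) hd (f := wedgeSum V W k))
  exact this.2 hs

end ext

/-! ## Equivariant vector bundles -/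

variable {G Y : Type} [Group G] [TopologicalSpace G] [TopologicalSpace Y] [MulAction G Y]

section functorial
variable {T V V₁ V₂ V₃ W W₁ W₂ W₃ : Type} [TopologicalSpace T]
  [AddCommGroup V] [Module ℂ V] [AddCommGroup W] [Module ℂ W]
  [AddCommGroup V₁] [Module ℂ V₁] [AddCommGroup W₁] [Module ℂ W₁]
  [AddCommGroup V₂] [Module ℂ V₂] [AddCommGroup W₂] [Module ℂ W₂]
  [AddCommGroup V₃] [Module ℂ V₃] [AddCommGroup W₃] [Module ℂ W₃]

theorem tensor_id {a : V →ₗ[ℂ] V} {b : W →ₗ[ℂ] W} (ha : ∀ v, a v = v) (hb : ∀ w, b w = w)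
    (x : V ⊗[ℂ] W) : TensorProduct.map a b x = x := by
  rw [show a = LinearMap.id from LinearMap.ext ha, show b = LinearMap.id from LinearMap.ext hb,
    TensorProduct.map_id]; rfl

theorem tensor_comp {a : V₁ →ₗ[ℂ] V₂} {a' : V →ₗ[ℂ] V₁} {c : V →ₗ[ℂ] V₂}
    {b : W₁ →ₗ[ℂ] W₂} {b' : W →ₗ[ℂ] W₁} {d : W →ₗ[ℂ] W₂} (ha : ∀ v, c v = a (a' v))
    (hb : ∀ w, d w = b (b' w)) (x : V ⊗[ℂ] W) :
    TensorProduct.map c d x = TensorProduct.map a b (TensorProduct.map a' b' x) := by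
  rw [show c = a ∘ₗ a' from LinearMap.ext ha, show d = b ∘ₗ b' from LinearMap.ext hb,
    TensorProduct.map_comp]; rfl

theorem tensor_wcts [FiniteDimensional ℂ V₁] {S : Set T} {a : T → V →ₗ[ℂ] V₁}
    {b : T → W →ₗ[ℂ] W₁} (ha : ∀ v, WCts (fun t => a t v) S) (hb : ∀ w, WCts (fun t => b t w) S)
    (x : V ⊗[ℂ] W) : WCts (fun t => TensorProduct.map (a t) (b t) x) S := by
  induction x with
  | zero => simpa using WCts.const _
  | add a b ha hb => simpa only [map_add] using ha.add hb
  | tmul v w => simpa only [TensorProduct.map_tmul] using (ha v).tmul (hb w)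

theorem exterior_id {k : ℕ} {a : V →ₗ[ℂ] V} (ha : ∀ v, a v = v) (x : ⋀[ℂ]^k V) :
    exteriorPower.map k a x = x := by
  rw [show a = LinearMap.id from LinearMap.ext ha, exteriorPower.map_id]; rfl

theorem exterior_comp {k : ℕ} {a : V₁ →ₗ[ℂ] V₂} {a' : V →ₗ[ℂ] V₁} {c : V →ₗ[ℂ] V₂}
    (ha : ∀ v, c v = a (a' v)) (x : ⋀[ℂ]^k V) :
    exteriorPower.map k c x = exteriorPower.map k a (exteriorPower.map k a' x) := by
  rw [show c = a ∘ₗ a' from LinearMap.ext ha, exteriorPower.map_comp]; rfl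

theorem exterior_wcts {k : ℕ} [FiniteDimensional ℂ V₁] {S : Set T} {a : T → V →ₗ[ℂ] V₁}
    (ha : ∀ v, WCts (fun t => a t v) S) (x : ⋀[ℂ]^k V) :
    WCts (fun t => exteriorPower.map k (a t) x) S := by
  have hx : x ∈ Submodule.span ℂ (Set.range (exteriorPower.ιMulti ℂ k (M := V))) := by
    rw [exteriorPower.ιMulti_span]; trivial
  induction hx using Submodule.span_induction with
  | mem x hx =>
    obtain ⟨m, rfl⟩ := hx
    refine (WCts.multilinear (exteriorPower.ιMulti ℂ k (M := V₁)).toMultilinearMap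
      (fun i => ha (m i))).congr fun a _ => ?_
    simp only [exteriorPower.map_apply_ιMulti]; rfl
  | zero => simpa using WCts.const _
  | add a b _ _ ha hb => simpa only [map_add] using ha.add hb
  | smul c a _ ha => simpa only [map_smul] using WCts.smul continuousOn_const ha

end functorial

/-- A `G`-equivariant topological complex vector bundle (of locally constant finite rank) on the
`G`-space `Y`: a family of finite-dimensional complex vector spaces `Fib y`, with
* a local trivialization around every point `p`: on the open neighbourhood `nbhd p` of `p`, linear
  isomorphisms `triv p y : Fib p → Fib y` with inverses `coord p y` (the values of `triv p y` and
  `coord p y` for `y` outside `nbhd p` carry no information);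
* a fibrewise linear `G`-action `act g y y' _ : Fib y → Fib y'`, where `y' = g • y`, compatible with
  the unit and the multiplication of `G`;
* continuity: read in the trivializations, the map `(g, y) ↦ (g : Fib y → Fib (g • y))` is
  continuous. For `g = 1` this says that the changes of trivialization are continuous, so that the
  total space gets its topology; in general it says that `G` acts continuously on the total space. -/
structure EqBundle (G Y : Type) [Group G] [TopologicalSpace G] [TopologicalSpace Y]
    [MulAction G Y] : Type 1 where
  /-- the fibres -/
  Fib : Y → Type
  [grp : ∀ y, AddCommGroup (Fib y)]
  [mod : ∀ y, Module ℂ (Fib y)]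
  [fin : ∀ y, FiniteDimensional ℂ (Fib y)]
  /-- the neighbourhood of `p` on which the bundle is trivialized -/
  nbhd : Y → Set Y
  nbhd_open : ∀ p, IsOpen (nbhd p)
  mem_nbhd : ∀ p, p ∈ nbhd p
  /-- the trivialization around `p` -/
  triv : ∀ p y, Fib p →ₗ[ℂ] Fib y
  /-- the inverse of the trivialization -/
  coord : ∀ p y, Fib y →ₗ[ℂ] Fib p
  coord_triv : ∀ p, ∀ y ∈ nbhd p, ∀ v, coord p y (triv p y v) = v
  triv_coord : ∀ p, ∀ y ∈ nbhd p, ∀ v, triv p y (coord p y v) = v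
  /-- the action of `g` from the fibre at `y` to the fibre at `y' = g • y` -/
  act : ∀ (g : G) (y y' : Y), g • y = y' → Fib y →ₗ[ℂ] Fib y'
  act_one : ∀ y (h : (1 : G) • y = y) v, act 1 y y h v = v
  act_mul : ∀ (g g' : G) y y' y'' (h : g' • y = y') (h' : g • y' = y'')
    (h'' : (g * g') • y = y'') v, act (g * g') y y'' h'' v = act g y' y'' h' (act g' y y' h v)
  cts : ∀ p q v, WCts (fun a : G × Y => coord q (a.1 • a.2) (act a.1 a.2 _ rfl (triv p a.2 v)))
    {a | a.2 ∈ nbhd p ∧ a.1 • a.2 ∈ nbhd q}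

namespace EqBundle

attribute [instance] grp mod fin

theorem cts_trans (E : EqBundle G Y) (p q : Y) (v : E.Fib p) :
    WCts (fun y => E.coord q y (E.triv p y v)) (E.nbhd p ∩ E.nbhd q) := by
  have h := (E.cts p q v).comp (u := fun y : Y => ((1 : G), y)) (S' := E.nbhd p ∩ E.nbhd q)
    (by fun_prop) (fun y hy => by simpa using hy)
  refine h.congr fun y _ => ?_
  have : ∀ y' (e : (1 : G) • y = y'), E.coord q y (E.triv p y v) =
      E.coord q y' (E.act 1 y y' e (E.triv p y v)) := by
    intro y' e
    obtain rfl : y = y' := by simpa using e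
    rw [E.act_one]
  exact this _ rfl

/-- A homomorphism of equivariant vector bundles over the identity of `Y`: fibrewise linear,
equivariant, and continuous when read in the local trivializations. -/
structure Hom (E F : EqBundle G Y) where
  /-- the map on fibres -/
  map : ∀ y, E.Fib y →ₗ[ℂ] F.Fib y
  equivariant : ∀ (g : G) y y' (h : g • y = y') v,
    map y' (E.act g y y' h v) = F.act g y y' h (map y v)
  cts : ∀ p q v, WCts (fun y => F.coord q y (map y (E.triv p y v))) (E.nbhd p ∩ F.nbhd q)

/-- The identity homomorphism. -/
def Hom.id (E : EqBundle G Y) : Hom E E where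
  map _ := LinearMap.id
  equivariant _ _ _ _ _ := rfl
  cts p q v := E.cts_trans p q v

/-- Composition of homomorphisms. -/
def Hom.comp {E F H : EqBundle G Y} (b : Hom F H) (a : Hom E F) : Hom E H where
  map y := b.map y ∘ₗ a.map y
  equivariant g y y' h v := by simp [a.equivariant, b.equivariant]
  cts p q v := fun ℓ y₀ hy₀ => by
    have h : WCts (fun y => H.coord q y (b.map y (F.triv y₀ y
        (F.coord y₀ y (a.map y (E.triv p y v)))))) (E.nbhd p ∩ H.nbhd q ∩ F.nbhd y₀) :=
      WCts.apply (A := fun y => H.coord q y ∘ₗ b.map y ∘ₗ F.triv y₀ y)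
        (fun w => (b.cts y₀ q w).mono fun y hy => ⟨hy.2, hy.1.2⟩)
        ((a.cts p y₀ v).mono fun y hy => ⟨hy.1.1, hy.2⟩)
    have h2 := (h.congr (f' := fun y => H.coord q y (b.map y (a.map y (E.triv p y v))))
      fun y hy => by rw [F.triv_coord y₀ y hy.2]) ℓ y₀ ⟨hy₀, F.mem_nbhd y₀⟩
    exact h2.mono_of_mem_nhdsWithin (Filter.inter_mem self_mem_nhdsWithin
      (mem_nhdsWithin_of_mem_nhds ((F.nbhd_open y₀).mem_nhds (F.mem_nbhd y₀))))

/-- Two equivariant bundles are isomorphic. -/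
def Iso (E F : EqBundle G Y) : Prop :=
  ∃ (a : Hom E F) (b : Hom F E), (∀ y v, b.map y (a.map y v) = v) ∧
    ∀ y v, a.map y (b.map y v) = v

theorem Iso.refl (E : EqBundle G Y) : Iso E E := ⟨.id E, .id E, fun _ _ => rfl, fun _ _ => rfl⟩

theorem Iso.symm {E F : EqBundle G Y} : Iso E F → Iso F E :=
  fun ⟨a, b, h, h'⟩ => ⟨b, a, h', h⟩

theorem Iso.trans {E F H : EqBundle G Y} : Iso E F → Iso F H → Iso E H :=
  fun ⟨a, b, h, h'⟩ ⟨c, d, k, k'⟩ => ⟨c.comp a, b.comp d,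
    fun y v => by simp [Hom.comp, k, h], fun y v => by simp [Hom.comp, h', k']⟩

/-- A fibrewise linear equivariant map that is constant in the local trivializations. -/
def Hom.ofNatural {E F : EqBundle G Y} (e : ∀ y, E.Fib y →ₗ[ℂ] F.Fib y)
    (hact : ∀ (g : G) y y' (h : g • y = y') v, e y' (E.act g y y' h v) = F.act g y y' h (e y v))
    (hn : ∀ p, E.nbhd p ⊆ F.nbhd p)
    (ht : ∀ p y v, e y (E.triv p y v) = F.triv p y (e p v)) : Hom E F where
  map := e
  equivariant := hact
  cts p q v := ((F.cts_trans p q (e p v)).mono fun y hy => ⟨hn p hy.1, hy.2⟩).congr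
    fun y _ => by rw [ht]

theorem Iso.ofNatural {E F : EqBundle G Y} (e : ∀ y, E.Fib y ≃ₗ[ℂ] F.Fib y)
    (hact : ∀ (g : G) y y' (h : g • y = y') v, e y' (E.act g y y' h v) = F.act g y y' h (e y v))
    (hn : ∀ p, E.nbhd p = F.nbhd p)
    (ht : ∀ p y v, e y (E.triv p y v) = F.triv p y (e p v)) : Iso E F :=
  ⟨.ofNatural (fun y => (e y).toLinearMap) hact (fun p => (hn p).subset) ht,
   .ofNatural (fun y => (e y).symm.toLinearMap)
    (fun g y y' h v => by simp [LinearEquiv.symm_apply_eq, hact]) (fun p => (hn p).superset)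
    (fun p y v => by simp [LinearEquiv.symm_apply_eq, ht]),
   fun y v => (e y).symm_apply_apply v, fun y v => (e y).apply_symm_apply v⟩

/-- The trivial bundle `Y × V` of a continuous finite-dimensional representation `V` of `G`. -/
def ofRep (Y : Type) [TopologicalSpace Y] [MulAction G Y] {V : Type} [AddCommGroup V] [Module ℂ V]
    [FiniteDimensional ℂ V] (ρ : Representation ℂ G V)
    (hρ : ∀ v, WCts (fun g => ρ g v) Set.univ) : EqBundle G Y where
  Fib _ := V
  nbhd _ := Set.univ
  nbhd_open _ := isOpen_univ
  mem_nbhd _ := trivial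
  triv _ _ := LinearMap.id
  coord _ _ := LinearMap.id
  coord_triv _ _ _ _ := rfl
  triv_coord _ _ _ _ := rfl
  act g _ _ _ := ρ g
  act_one := by simp
  act_mul := by simp
  cts _ _ v := (hρ v).comp (by fun_prop) (fun _ _ => trivial)

/-- The zero bundle. -/
def zero : EqBundle G Y :=
  ofRep Y (1 : Representation ℂ G PUnit) fun _ => WCts.const _

/-- The trivial line bundle, with trivial action. -/
def unit : EqBundle G Y :=
  ofRep Y (1 : Representation ℂ G ℂ) fun _ => WCts.const _

/-- The direct sum of two bundles. -/
def sum (E F : EqBundle G Y) : EqBundle G Y where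
  Fib y := E.Fib y × F.Fib y
  nbhd p := E.nbhd p ∩ F.nbhd p
  nbhd_open p := (E.nbhd_open p).inter (F.nbhd_open p)
  mem_nbhd p := ⟨E.mem_nbhd p, F.mem_nbhd p⟩
  triv p y := (E.triv p y).prodMap (F.triv p y)
  coord p y := (E.coord p y).prodMap (F.coord p y)
  coord_triv p y h v := by simp [E.coord_triv p y h.1, F.coord_triv p y h.2]
  triv_coord p y h v := by simp [E.triv_coord p y h.1, F.triv_coord p y h.2]
  act g y y' h := (E.act g y y' h).prodMap (F.act g y y' h)
  act_one y h v := by simp [act_one]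
  act_mul g g' y y' y'' h h' h'' v := by
    simp [E.act_mul g g' y y' y'' h h' h'', F.act_mul g g' y y' y'' h h' h'']
  cts p q v := ((E.cts p q v.1).mono fun _ h => ⟨h.1.1, h.2.1⟩).prodMk
    ((F.cts p q v.2).mono fun _ h => ⟨h.1.2, h.2.2⟩)

/-- The tensor product of two bundles. -/
def tensor (E F : EqBundle G Y) : EqBundle G Y where
  Fib y := E.Fib y ⊗[ℂ] F.Fib y
  nbhd p := E.nbhd p ∩ F.nbhd p
  nbhd_open p := (E.nbhd_open p).inter (F.nbhd_open p)
  mem_nbhd p := ⟨E.mem_nbhd p, F.mem_nbhd p⟩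
  triv p y := TensorProduct.map (E.triv p y) (F.triv p y)
  coord p y := TensorProduct.map (E.coord p y) (F.coord p y)
  coord_triv p y h v := (tensor_comp (fun _ => rfl) (fun _ => rfl) v).symm.trans
    (tensor_id (a := E.coord p y ∘ₗ E.triv p y) (b := F.coord p y ∘ₗ F.triv p y)
      (E.coord_triv p y h.1) (F.coord_triv p y h.2) v)
  triv_coord p y h v := (tensor_comp (fun _ => rfl) (fun _ => rfl) v).symm.trans
    (tensor_id (a := E.triv p y ∘ₗ E.coord p y) (b := F.triv p y ∘ₗ F.coord p y)
      (E.triv_coord p y h.1) (F.triv_coord p y h.2) v)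
  act g y y' h := TensorProduct.map (E.act g y y' h) (F.act g y y' h)
  act_one y h v := tensor_id (E.act_one y h) (F.act_one y h) v
  act_mul g g' y y' y'' h h' h'' v :=
    tensor_comp (E.act_mul g g' y y' y'' h h' h'') (F.act_mul g g' y y' y'' h h' h'') v
  cts p q v := (tensor_wcts
      (a := fun a : G × Y => E.coord q (a.1 • a.2) ∘ₗ E.act a.1 a.2 _ rfl ∘ₗ E.triv p a.2)
      (b := fun a : G × Y => F.coord q (a.1 • a.2) ∘ₗ F.act a.1 a.2 _ rfl ∘ₗ F.triv p a.2)
      (fun v => (E.cts p q v).mono fun _ h => ⟨h.1.1, h.2.1⟩)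
      (fun v => (F.cts p q v).mono fun _ h => ⟨h.1.2, h.2.2⟩) v).congr fun a _ => by
    rw [TensorProduct.map_comp, TensorProduct.map_comp]; rfl

/-- The `k`-th exterior power of a bundle. -/
def ext (k : ℕ) (E : EqBundle G Y) : EqBundle G Y where
  Fib y := ⋀[ℂ]^k (E.Fib y)
  nbhd := E.nbhd
  nbhd_open := E.nbhd_open
  mem_nbhd := E.mem_nbhd
  triv p y := exteriorPower.map k (E.triv p y)
  coord p y := exteriorPower.map k (E.coord p y)
  coord_triv p y h v := (exterior_comp (fun _ => rfl) v).symm.trans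
    (exterior_id (a := E.coord p y ∘ₗ E.triv p y) (E.coord_triv p y h) v)
  triv_coord p y h v := (exterior_comp (fun _ => rfl) v).symm.trans
    (exterior_id (a := E.triv p y ∘ₗ E.coord p y) (E.triv_coord p y h) v)
  act g y y' h := exteriorPower.map k (E.act g y y' h)
  act_one y h v := exterior_id (E.act_one y h) v
  act_mul g g' y y' y'' h h' h'' v := exterior_comp (E.act_mul g g' y y' y'' h h' h'') v
  cts p q v := (exterior_wcts
      (a := fun a : G × Y => E.coord q (a.1 • a.2) ∘ₗ E.act a.1 a.2 _ rfl ∘ₗ E.triv p a.2)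
      (fun v => E.cts p q v) v).congr fun a _ => by
    rw [exteriorPower.map_comp, exteriorPower.map_comp]; rfl

/-- The direct sum of a finite family of bundles. -/
def pi {m : ℕ} (E : Fin m → EqBundle G Y) : EqBundle G Y where
  Fib y := ∀ i, (E i).Fib y
  nbhd p := ⋂ i, (E i).nbhd p
  nbhd_open p := isOpen_iInter_of_finite fun i => (E i).nbhd_open p
  mem_nbhd p := Set.mem_iInter.2 fun i => (E i).mem_nbhd p
  triv p y := LinearMap.piMap fun i => (E i).triv p y
  coord p y := LinearMap.piMap fun i => (E i).coord p y
  coord_triv p y h v := funext fun i => (E i).coord_triv p y (Set.mem_iInter.1 h i) _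
  triv_coord p y h v := funext fun i => (E i).triv_coord p y (Set.mem_iInter.1 h i) _
  act g y y' h := LinearMap.piMap fun i => (E i).act g y y' h
  act_one y h v := funext fun i => (E i).act_one y h _
  act_mul g g' y y' y'' h h' h'' v := funext fun i => (E i).act_mul g g' y y' y'' h h' h'' _
  cts p q v := WCts.pi fun i => ((E i).cts p q (v i)).mono
    fun _ h => ⟨Set.mem_iInter.1 h.1 i, Set.mem_iInter.1 h.2 i⟩

theorem Iso.sum {E E' F F' : EqBundle G Y} : Iso E E' → Iso F F' → Iso (E.sum F) (E'.sum F') := by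
  have key : ∀ {E E' F F' : EqBundle G Y} (a : Hom E E') (b : Hom F F'),
      ∃ c : Hom (E.sum F) (E'.sum F'), ∀ y, c.map y = (a.map y).prodMap (b.map y) :=
    fun {E E' F F'} a b => ⟨{
      map := fun y => (a.map y).prodMap (b.map y)
      equivariant := fun g y y' h v => Prod.ext (a.equivariant g y y' h v.1) (b.equivariant g y y' h v.2)
      cts := fun p q v => ((a.cts p q v.1).mono fun _ h => ⟨h.1.1, h.2.1⟩).prodMk
        ((b.cts p q v.2).mono fun _ h => ⟨h.1.2, h.2.2⟩) }, fun _ => rfl⟩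
  rintro ⟨a, a', h, h'⟩ ⟨b, b', k, k'⟩
  obtain ⟨c, hc⟩ := key a b
  obtain ⟨c', hc'⟩ := key a' b'
  exact ⟨c, c', fun y v => by rw [hc, hc']; exact Prod.ext (h y _) (k y _),
    fun y v => by rw [hc, hc']; exact Prod.ext (h' y _) (k' y _)⟩

theorem Iso.tensor {E E' F F' : EqBundle G Y} :
    Iso E E' → Iso F F' → Iso (E.tensor F) (E'.tensor F') := by
  have key : ∀ {E E' F F' : EqBundle G Y} (a : Hom E E') (b : Hom F F'),
      ∃ c : Hom (E.tensor F) (E'.tensor F'), ∀ y, c.map y = TensorProduct.map (a.map y) (b.map y) :=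
    fun {E E' F F'} a b => ⟨{
      map := fun y => TensorProduct.map (a.map y) (b.map y)
      equivariant := fun g y y' h v => (tensor_comp (fun _ => rfl) (fun _ => rfl) v).symm.trans
        (tensor_comp (c := a.map y' ∘ₗ E.act g y y' h) (d := b.map y' ∘ₗ F.act g y y' h)
          (a.equivariant g y y' h) (b.equivariant g y y' h) v)
      cts := fun p q v => (tensor_wcts
        (a := fun y => E'.coord q y ∘ₗ a.map y ∘ₗ E.triv p y)
        (b := fun y => F'.coord q y ∘ₗ b.map y ∘ₗ F.triv p y)
        (fun v => (a.cts p q v).mono fun _ h => ⟨h.1.1, h.2.1⟩)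
        (fun v => (b.cts p q v).mono fun _ h => ⟨h.1.2, h.2.2⟩) v).congr fun y _ => by
          rw [TensorProduct.map_comp, TensorProduct.map_comp]; rfl }, fun _ => rfl⟩
  rintro ⟨a, a', h, h'⟩ ⟨b, b', k, k'⟩
  obtain ⟨c, hc⟩ := key a b
  obtain ⟨c', hc'⟩ := key a' b'
  refine ⟨c, c', fun y v => ?_, fun y v => ?_⟩
  · rw [hc, hc']
    exact (tensor_comp (fun _ => rfl) (fun _ => rfl) v).symm.trans
      (tensor_id (a := a'.map y ∘ₗ a.map y) (b := b'.map y ∘ₗ b.map y) (h y) (k y) v)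
  · rw [hc, hc']
    exact (tensor_comp (fun _ => rfl) (fun _ => rfl) v).symm.trans
      (tensor_id (a := a.map y ∘ₗ a'.map y) (b := b.map y ∘ₗ b'.map y) (h' y) (k' y) v)

theorem Iso.ext (k : ℕ) {E F : EqBundle G Y} : Iso E F → Iso (E.ext k) (F.ext k) := by
  have key : ∀ {E F : EqBundle G Y} (a : Hom E F),
      ∃ c : Hom (E.ext k) (F.ext k), ∀ y, c.map y = exteriorPower.map k (a.map y) :=
    fun {E F} a => ⟨{
      map := fun y => exteriorPower.map k (a.map y)
      equivariant := fun g y y' h v => (exterior_comp (fun _ => rfl) v).symm.trans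
        (exterior_comp (c := a.map y' ∘ₗ E.act g y y' h) (a.equivariant g y y' h) v)
      cts := fun p q v => (exterior_wcts (a := fun y => F.coord q y ∘ₗ a.map y ∘ₗ E.triv p y)
        (fun v => a.cts p q v) v).congr fun y _ => by
          rw [exteriorPower.map_comp, exteriorPower.map_comp]; rfl }, fun _ => rfl⟩
  rintro ⟨a, a', h, h'⟩
  obtain ⟨c, hc⟩ := key a
  obtain ⟨c', hc'⟩ := key a'
  refine ⟨c, c', fun y v => ?_, fun y v => ?_⟩
  · rw [hc, hc']
    exact (exterior_comp (fun _ => rfl) v).symm.trans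
      (exterior_id (a := a'.map y ∘ₗ a.map y) (h y) v)
  · rw [hc, hc']
    exact (exterior_comp (fun _ => rfl) v).symm.trans
      (exterior_id (a := a.map y ∘ₗ a'.map y) (h' y) v)

/-! ### Natural isomorphisms -/

theorem sum_comm (E F : EqBundle G Y) : Iso (E.sum F) (F.sum E) :=
  .ofNatural (fun _ => LinearEquiv.prodComm ℂ _ _) (fun _ _ _ _ _ => rfl)
    (fun _ => Set.inter_comm _ _) (fun _ _ _ => rfl)

theorem sum_assoc (E F H : EqBundle G Y) : Iso ((E.sum F).sum H) (E.sum (F.sum H)) :=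
  .ofNatural (fun _ => LinearEquiv.prodAssoc ℂ _ _ _) (fun _ _ _ _ _ => rfl)
    (fun _ => Set.inter_assoc _ _ _) (fun _ _ _ => rfl)

theorem zero_sum (E : EqBundle G Y) : Iso (zero.sum E) E :=
  .ofNatural (fun _ => LinearEquiv.uniqueProd (M₂ := PUnit)) (fun _ _ _ _ _ => rfl)
    (fun _ => Set.univ_inter _) (fun _ _ _ => rfl)

theorem tensor_comm (E F : EqBundle G Y) : Iso (E.tensor F) (F.tensor E) :=
  .ofNatural (fun _ => TensorProduct.comm ℂ _ _)
    (fun _ _ _ _ v => (TensorProduct.map_comm _ _ v).symm)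
    (fun _ => Set.inter_comm _ _) (fun _ _ v => (TensorProduct.map_comm _ _ v).symm)

theorem tensor_assoc (E F H : EqBundle G Y) :
    Iso ((E.tensor F).tensor H) (E.tensor (F.tensor H)) :=
  .ofNatural (fun _ => TensorProduct.assoc ℂ _ _ _)
    (fun _ _ _ _ v => (TensorProduct.map_map_assoc _ _ _ v).symm)
    (fun _ => Set.inter_assoc _ _ _) (fun _ _ v => (TensorProduct.map_map_assoc _ _ _ v).symm)

theorem unit_tensor (E : EqBundle G Y) : Iso (unit.tensor E) E := by
  have key : ∀ {V W : Type} [AddCommGroup V] [Module ℂ V] [AddCommGroup W] [Module ℂ W]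
      (f : V →ₗ[ℂ] W) (e : ℂ →ₗ[ℂ] ℂ) (_ : ∀ c, e c = c) (x : ℂ ⊗[ℂ] V),
      TensorProduct.lid ℂ W (TensorProduct.map e f x) = f (TensorProduct.lid ℂ V x) := by
    intro V W _ _ _ _ f e he x
    induction x with
    | zero => simp
    | add a b ha hb => simp only [map_add, ha, hb]
    | tmul c v => simp [he]
  exact .ofNatural (fun _ => TensorProduct.lid ℂ _) (fun _ _ _ _ v => key _ _ (fun _ => rfl) v)
    (fun _ => Set.univ_inter _) (fun _ _ v => key _ _ (fun _ => rfl) v)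

theorem sum_tensor (E F H : EqBundle G Y) :
    Iso ((E.sum F).tensor H) ((E.tensor H).sum (F.tensor H)) := by
  have key : ∀ {A A' B B' C C' : Type} [AddCommGroup A] [Module ℂ A] [AddCommGroup A']
      [Module ℂ A'] [AddCommGroup B] [Module ℂ B] [AddCommGroup B'] [Module ℂ B']
      [AddCommGroup C] [Module ℂ C] [AddCommGroup C'] [Module ℂ C']
      (a : A →ₗ[ℂ] A') (b : B →ₗ[ℂ] B') (c : C →ₗ[ℂ] C') (x : (A × B) ⊗[ℂ] C),
      TensorProduct.prodLeft ℂ ℂ A' B' C' (TensorProduct.map (a.prodMap b) c x) =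
        ((TensorProduct.map a c).prodMap (TensorProduct.map b c))
          (TensorProduct.prodLeft ℂ ℂ A B C x) := by
    intro A A' B B' C C' _ _ _ _ _ _ _ _ _ _ _ _ a b c x
    induction x with
    | zero => simp; rfl
    | add a b ha hb => simp only [map_add, ha, hb]
    | tmul v w => obtain ⟨v₁, v₂⟩ := v; simp
  refine .ofNatural (fun _ => TensorProduct.prodLeft ℂ ℂ _ _ _) (fun _ _ _ _ v => key _ _ _ v)
    (fun p => ?_) (fun _ _ v => key _ _ _ v)
  change E.nbhd p ∩ F.nbhd p ∩ H.nbhd p = E.nbhd p ∩ H.nbhd p ∩ (F.nbhd p ∩ H.nbhd p)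
  ext; simp; tauto

theorem iso_zero (E : EqBundle G Y) (h : ∀ y, Subsingleton (E.Fib y)) : Iso E zero :=
  ⟨⟨fun _ => 0, fun _ _ _ _ _ => rfl, fun _ _ _ => WCts.const (0 : PUnit)⟩,
    ⟨fun _ => 0, fun _ _ _ _ _ => (h _).elim _ _,
      fun _ q _ => (WCts.const (0 : E.Fib q)).congr fun _ _ => (h _).elim _ _⟩,
    fun _ _ => (h _).elim _ _, fun _ _ => rfl⟩

theorem zero_tensor (E : EqBundle G Y) : Iso (zero.tensor E) zero :=
  iso_zero _ fun y => by
    change Subsingleton (PUnit ⊗[ℂ] E.Fib y)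
    infer_instance

theorem ext_zero (E : EqBundle G Y) : Iso (E.ext 0) unit := by
  have key : ∀ {V W : Type} [AddCommGroup V] [Module ℂ V] [AddCommGroup W] [Module ℂ W]
      (f : V →ₗ[ℂ] W) (x : ⋀[ℂ]^0 V),
      exteriorPower.zeroEquiv ℂ W (exteriorPower.map 0 f x) = exteriorPower.zeroEquiv ℂ V x :=
    fun f x => LinearMap.congr_fun (exteriorPower.zeroEquiv_naturality f) x
  have key' : ∀ {V W : Type} [AddCommGroup V] [Module ℂ V] [AddCommGroup W] [Module ℂ W]
      (f : V →ₗ[ℂ] W) (c : ℂ),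
      exteriorPower.map 0 f ((exteriorPower.zeroEquiv ℂ V).symm c) =
        (exteriorPower.zeroEquiv ℂ W).symm c := fun f c => by
    rw [LinearEquiv.eq_symm_apply, key, LinearEquiv.apply_symm_apply]
  exact ⟨.ofNatural (fun y => (exteriorPower.zeroEquiv ℂ (E.Fib y)).toLinearMap)
      (fun _ _ _ _ v => key _ v) (fun _ => Set.subset_univ _) (fun _ _ v => key _ v),
    ⟨fun y => (exteriorPower.zeroEquiv ℂ (E.Fib y)).symm.toLinearMap,
      fun _ _ _ _ v => (key' _ v).symm,
      fun _ q v => (WCts.const ((exteriorPower.zeroEquiv ℂ (E.Fib q)).symm v)).congr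
        fun _ _ => key' _ v⟩,
    fun y v => (exteriorPower.zeroEquiv ℂ (E.Fib y)).symm_apply_apply v,
    fun y v => (exteriorPower.zeroEquiv ℂ (E.Fib y)).apply_symm_apply v⟩

theorem pi_zero (E : Fin 0 → EqBundle G Y) : Iso (pi E) zero :=
  iso_zero _ fun y => by
    change Subsingleton (∀ i : Fin 0, (E i).Fib y)
    infer_instance

theorem pi_succ {m : ℕ} (E : Fin (m + 1) → EqBundle G Y) :
    Iso ((E 0).sum (pi fun i => E i.succ)) (pi E) := by
  refine .ofNatural (fun y => Fin.consLinearEquiv ℂ fun i => (E i).Fib y)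
    (fun g y y' h v => ?_) (fun p => ?_) (fun p y v => ?_)
  · funext i; cases i using Fin.cases <;> rfl
  · ext y
    change (y ∈ (E 0).nbhd p ∧ y ∈ ⋂ i : Fin m, (E i.succ).nbhd p) ↔ y ∈ ⋂ i, (E i).nbhd p
    simp [Fin.forall_fin_succ]
  · funext i; cases i using Fin.cases <;> rfl

theorem ext_sum (k : ℕ) (E F : EqBundle G Y) :
    Iso (pi fun i : Fin (k + 1) => (E.ext i).tensor (F.ext (k - i))) ((E.sum F).ext k) :=
  .ofNatural (fun y => LinearEquiv.ofBijective _ (wedgeSum_bijective (E.Fib y) (F.Fib y) k))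
    (fun _ _ _ _ v => wedgeSum_natural k _ _ v) (fun p => Set.iInter_const (E.nbhd p ∩ F.nbhd p))
    (fun _ _ v => wedgeSum_natural k _ _ v)

instance setoid (G Y : Type) [Group G] [TopologicalSpace G] [TopologicalSpace Y]
    [MulAction G Y] : Setoid (EqBundle G Y) :=
  ⟨Iso, Iso.refl, Iso.symm, Iso.trans⟩

end EqBundle

/-! ## The Grothendieck ring and its Adams operations -/

/-- Isomorphism classes of `G`-equivariant complex vector bundles on `Y`. -/
def VectClass (G Y : Type) [Group G] [TopologicalSpace G] [TopologicalSpace Y]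
    [MulAction G Y] : Type 1 := Quotient (EqBundle.setoid G Y)

namespace VectClass
open EqBundle

/-- The isomorphism class of a bundle. -/
def mk (E : EqBundle G Y) : VectClass G Y := Quotient.mk _ E

instance : Add (VectClass G Y) :=
  ⟨Quotient.map₂ EqBundle.sum fun _ _ h _ _ k => Iso.sum h k⟩

instance : Mul (VectClass G Y) :=
  ⟨Quotient.map₂ EqBundle.tensor fun _ _ h _ _ k => Iso.tensor h k⟩

instance : Zero (VectClass G Y) := ⟨mk EqBundle.zero⟩

instance : One (VectClass G Y) := ⟨mk EqBundle.unit⟩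

/-- Isomorphism classes form a semiring under direct sum and tensor product. -/
instance : CommSemiring (VectClass G Y) where
  nsmul := nsmulRec
  add_assoc := by rintro ⟨E⟩ ⟨F⟩ ⟨H⟩; exact Quotient.sound (sum_assoc E F H)
  add_comm := by rintro ⟨E⟩ ⟨F⟩; exact Quotient.sound (sum_comm E F)
  zero_add := by rintro ⟨E⟩; exact Quotient.sound (zero_sum E)
  add_zero := by rintro ⟨E⟩; exact Quotient.sound ((sum_comm E _).trans (zero_sum E))
  mul_assoc := by rintro ⟨E⟩ ⟨F⟩ ⟨H⟩; exact Quotient.sound (tensor_assoc E F H)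
  mul_comm := by rintro ⟨E⟩ ⟨F⟩; exact Quotient.sound (tensor_comm E F)
  one_mul := by rintro ⟨E⟩; exact Quotient.sound (unit_tensor E)
  mul_one := by rintro ⟨E⟩; exact Quotient.sound ((tensor_comm E _).trans (unit_tensor E))
  zero_mul := by rintro ⟨E⟩; exact Quotient.sound (zero_tensor E)
  mul_zero := by rintro ⟨E⟩; exact Quotient.sound ((tensor_comm E _).trans (zero_tensor E))
  right_distrib := by rintro ⟨E⟩ ⟨F⟩ ⟨H⟩; exact Quotient.sound (sum_tensor E F H)
  left_distrib := by
    rintro ⟨E⟩ ⟨F⟩ ⟨H⟩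
    exact Quotient.sound ((tensor_comm E _).trans ((sum_tensor F H E).trans
      (Iso.sum (tensor_comm F E) (tensor_comm H E))))

theorem mk_sum (E F : EqBundle G Y) : mk (E.sum F) = mk E + mk F := rfl

/-- The class of the `k`-th exterior power. -/
def lam (k : ℕ) : VectClass G Y → VectClass G Y :=
  Quotient.map (EqBundle.ext k) fun _ _ h => Iso.ext k h

theorem mk_pi {m : ℕ} (E : Fin m → EqBundle G Y) : mk (pi E) = ∑ i, mk (E i) := by
  induction m with
  | zero => exact Quotient.sound (pi_zero E)
  | succ m ih =>
    rw [Fin.sum_univ_succ, ← ih, ← mk_sum]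
    exact (Quotient.sound (pi_succ E)).symm

theorem lam_zero (a : VectClass G Y) : lam 0 a = 1 := by
  obtain ⟨E⟩ := a; exact Quotient.sound (ext_zero E)

theorem lam_add (k : ℕ) (a b : VectClass G Y) :
    lam k (a + b) = ∑ p ∈ Finset.HasAntidiagonal.antidiagonal k, lam p.1 a * lam p.2 b := by
  obtain ⟨E, rfl⟩ : ∃ E, mk E = a := Quotient.exists_rep a
  obtain ⟨F, rfl⟩ : ∃ F, mk F = b := Quotient.exists_rep b
  rw [Finset.Nat.sum_antidiagonal_eq_sum_range_succ fun i j => lam i _ * lam j _,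
    Finset.sum_range]
  exact (Quotient.sound (ext_sum k E F)).symm.trans (mk_pi _)

end VectClass

/-- The Grothendieck ring `K_G(Y)` of `G`-equivariant complex vector bundles on `Y`: the group
completion `ℤ ⊗[ℕ] M` of the semiring `M` of isomorphism classes. Its product is the usual one,
given by the tensor product of bundles. -/
def KTh (G Y : Type) [Group G] [TopologicalSpace G] [TopologicalSpace Y]
    [MulAction G Y] : Type 1 := ℤ ⊗[ℕ] VectClass G Y

instance : CommRing (KTh G Y) := inferInstanceAs (CommRing (ℤ ⊗[ℕ] VectClass G Y))

namespace KTh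

/-- The class in K-theory of an isomorphism class of bundles. -/
def ofClass : VectClass G Y →+* KTh G Y :=
  (Algebra.TensorProduct.includeRight : VectClass G Y →ₐ[ℕ] ℤ ⊗[ℕ] VectClass G Y).toRingHom

/-- The class `[E]` in K-theory of a bundle. -/
def cls (E : EqBundle G Y) : KTh G Y := ofClass (VectClass.mk E)

/-- The universal property of `K_G(Y)`: an additive function of isomorphism classes of bundles extends
to `K_G(Y)`. -/
def lift {H : Type 1} [AddCommGroup H] (f : VectClass G Y →+ H) : KTh G Y →+ H :=
  (TensorProduct.AlgebraTensorModule.lift (LinearMap.toSpanSingleton ℤ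
    (VectClass G Y →ₗ[ℕ] H) f.toNatLinearMap) : ℤ ⊗[ℕ] VectClass G Y →ₗ[ℤ] H).toAddMonoidHom

theorem lift_ofClass {H : Type 1} [AddCommGroup H] (f : VectClass G Y →+ H) (a : VectClass G Y) :
    lift f (ofClass a) = f a := by
  change (1 : ℤ) • f a = f a
  exact one_smul _ _

open PowerSeries

/-- The power series `λ_t(E) = ∑ᵢ tⁱ [⋀ⁱ E]`. -/
def lamSeries (a : VectClass G Y) : PowerSeries (KTh G Y) :=
  PowerSeries.mk fun i => ofClass (VectClass.lam i a)

theorem constantCoeff_lamSeries (a : VectClass G Y) : constantCoeff (lamSeries a) = 1 := by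
  rw [← coeff_zero_eq_constantCoeff_apply, lamSeries, coeff_mk, VectClass.lam_zero, map_one]

theorem lamSeries_add (a b : VectClass G Y) :
    lamSeries (a + b) = lamSeries a * lamSeries b := by
  ext k
  rw [coeff_mul, lamSeries, coeff_mk, VectClass.lam_add, map_sum]
  simp [lamSeries]

/-- The logarithmic derivative `t f'(t) / f(t)` of a power series `f` with constant term `1`. -/
def logDer {R : Type 1} [CommRing R] (f : PowerSeries R) : PowerSeries R :=
  X * derivative R f * invOfUnit f 1

theorem logDer_mul {R : Type 1} [CommRing R] (f g : PowerSeries R) (hf : constantCoeff f = 1)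
    (hg : constantCoeff g = 1) : logDer (f * g) = logDer f + logDer g := by
  have h1 := mul_invOfUnit f 1 hf
  have h2 := mul_invOfUnit g 1 hg
  have h3 := mul_invOfUnit (f * g) 1 (by simp [hf, hg])
  have h4 : invOfUnit (f * g) 1 = invOfUnit f 1 * invOfUnit g 1 := by
    calc _ = (f * invOfUnit f 1) * (g * invOfUnit g 1) * invOfUnit (f * g) 1 := by
            rw [h1, h2]; ring
      _ = (f * g * invOfUnit (f * g) 1) * (invOfUnit f 1 * invOfUnit g 1) := by ring
      _ = _ := by rw [h3, one_mul]
  rw [logDer, h4, Derivation.leibniz]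
  simp only [smul_eq_mul, logDer]
  linear_combination (X * derivative R g * invOfUnit g 1) * h1 + (X * derivative R f * invOfUnit f 1) * h2

/-- The Adams operations on classes of bundles. They are defined by
`λ_t(E) = exp (∑_{k ≥ 1} (-1)^(k-1) (t^k / k) ψ^k(E))`, that is, free of denominators, by
`t (d/dt) λ_t(E) / λ_t(E) = ∑_{k ≥ 1} (-1)^(k-1) ψ^k(E) t^k`. -/
def adamsClass (k : ℕ) : VectClass G Y →+ KTh G Y :=
  AddMonoidHom.mk' (fun a => (-1) ^ (k - 1) * coeff k (logDer (lamSeries a))) fun a b => by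
    rw [lamSeries_add, logDer_mul _ _ (constantCoeff_lamSeries a) (constantCoeff_lamSeries b),
      map_add, mul_add]

/-- The `k`-th Adams operation on `K_G(Y)`, for `k ≥ 1`. -/
def adams (k : ℕ) : KTh G Y →+ KTh G Y := lift (adamsClass k)

end KTh


/-! ## Characters of `ℂˣ` -/

theorem WCts.subtype {T V : Type} [TopologicalSpace T] [AddCommGroup V] [Module ℂ V]
    {P : Submodule ℂ V} {f : T → P} {S : Set T} (hf : WCts (fun t => (f t : V)) S) : WCts f S :=
  fun ℓ => by
    obtain ⟨L, hL⟩ := LinearMap.exists_extend ℓ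
    exact (hf L).congr fun t _ => by rw [← hL]; rfl

/-- The one-dimensional representation of `ℂˣ` with character `g ↦ gᵃ`. -/
def charRep (a : ℤ) : Representation ℂ ℂˣ ℂ where
  toFun g := ((g ^ a : ℂˣ) : ℂ) • LinearMap.id
  map_one' := by simp [Module.End.one_eq_id]
  map_mul' g h := by ext; simp [mul_zpow, mul_comm]

theorem charRep_apply (a : ℤ) (g : ℂˣ) (c : ℂ) : charRep a g c = ((g ^ a : ℂˣ) : ℂ) * c := rfl

theorem charRep_cts (a : ℤ) (c : ℂ) : WCts (fun g => charRep a g c) Set.univ := by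
  have h : Continuous fun g : ℂˣ => ((g ^ a : ℂˣ) : ℂ) :=
    Units.continuous_val.comp (continuous_zpow a)
  refine (WCts.smul (f := fun _ => c) h.continuousOn (WCts.const c)).congr fun g _ => ?_
  rfl

namespace KTh
variable {Y : Type} [TopologicalSpace Y] [MulAction ℂˣ Y]

/-- The equivariant line bundle on `Y` given by the character `g ↦ gᵃ`. -/
def lineBundle (a : ℤ) : EqBundle ℂˣ Y := EqBundle.ofRep Y (charRep a) (charRep_cts a)

theorem lineBundle_tensor (a b : ℤ) : EqBundle.Iso
    ((lineBundle a : EqBundle ℂˣ Y).tensor (lineBundle b)) (lineBundle (a + b)) := by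
  refine .ofNatural (fun _ => TensorProduct.lid ℂ ℂ) (fun g y y' h v => ?_)
    (fun _ => Set.univ_inter _) (fun p y v => ?_)
  · change TensorProduct.lid ℂ ℂ (TensorProduct.map (charRep a g) (charRep b g) v) =
      charRep (a + b) g (TensorProduct.lid ℂ ℂ v)
    change ℂ ⊗[ℂ] ℂ at v
    induction v with
    | zero => simp
    | add a b ha hb => simp only [map_add, ha, hb]
    | tmul c d => simp [charRep_apply, zpow_add]; ring
  · change TensorProduct.lid ℂ ℂ (TensorProduct.map LinearMap.id LinearMap.id v) =
      TensorProduct.lid ℂ ℂ v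
    rw [TensorProduct.map_id]; rfl

theorem lineBundle_zero : EqBundle.Iso (lineBundle 0 : EqBundle ℂˣ Y) EqBundle.unit :=
  .ofNatural (fun _ => LinearEquiv.refl ℂ ℂ)
    (fun g _ _ _ v => by
      change ((g ^ (0 : ℤ) : ℂˣ) : ℂ) * (show ℂ from v) = v
      rw [zpow_zero, Units.val_one, one_mul]) (fun _ => rfl) (fun _ _ _ => rfl)

theorem cls_lineBundle_mul (a b : ℤ) :
    cls (lineBundle a : EqBundle ℂˣ Y) * cls (lineBundle b : EqBundle ℂˣ Y) =
      cls (lineBundle (a + b)) := by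
  rw [cls, cls, ← map_mul]
  exact congrArg ofClass (Quotient.sound (lineBundle_tensor a b))

theorem cls_lineBundle_zero : cls (lineBundle 0 : EqBundle ℂˣ Y) = 1 := by
  rw [← map_one ofClass]
  exact congrArg ofClass (Quotient.sound lineBundle_zero)

/-- The class of the line bundle of the standard character, as a unit of `K_G(Y)`. -/
def charUnit (Y : Type) [TopologicalSpace Y] [MulAction ℂˣ Y] : (KTh ℂˣ Y)ˣ where
  val := cls (lineBundle 1)
  inv := cls (lineBundle (-1))
  val_inv := by rw [cls_lineBundle_mul]; exact cls_lineBundle_zero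
  inv_val := by rw [cls_lineBundle_mul]; exact cls_lineBundle_zero

end KTh

/-- `K_G(Y)` with complex coefficients. -/
abbrev KC (G Y : Type) [Group G] [TopologicalSpace G] [TopologicalSpace Y]
    [MulAction G Y] : Type 1 := ℂ ⊗[ℤ] KTh G Y

namespace KC

/-- The map `K_G(Y) → K_G(Y) ⊗ ℂ`. -/
def ofK : KTh G Y →+* KC G Y :=
  (Algebra.TensorProduct.includeRight : KTh G Y →ₐ[ℤ] KC G Y).toRingHom

/-- The class `[E]` of a bundle in `K_G(Y) ⊗ ℂ`. -/
def cls (E : EqBundle G Y) : KC G Y := ofK (KTh.cls E)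

/-- The `ℂ`-linear extension of the Adams operation `ψᵏ`. -/
def adams (k : ℕ) : KC G Y →ₗ[ℂ] KC G Y := (KTh.adams k).toIntLinearMap.baseChange ℂ

/-- The `k`-th Bott class `θᵏ(L) = 1 + L + ⋯ + Lᵏ⁻¹` of a line bundle `L` with class `u`.

It is also the Bott class of a bundle that has rank `1` on some components of `Y` and rank `0` on
the others: there the splitting principle gives the empty product `1`, which is the value of the sum
(its term with `i = 0` is `1`, the others vanish). -/
def bott (k : ℕ) (u : KC G Y) : KC G Y := ∑ i ∈ Finset.range k, u ^ i

open LaurentPolynomial in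
/-- The structure map `R(ℂˣ) ⊗ ℂ = ℂ[x, x⁻¹] → K_G(Y) ⊗ ℂ`, which takes the standard character `x` to the
class of its line bundle. -/
def fromRep (Y : Type) [TopologicalSpace Y] [MulAction ℂˣ Y] : ℂ[T;T⁻¹] →+* KC ℂˣ Y :=
  LaurentPolynomial.eval₂ (algebraMap ℂ (KC ℂˣ Y)) (Units.map ofK.toMonoidHom (KTh.charUnit Y))

end KC

/-! ## The weighted projective line -/

namespace WeightedLine

/-- The representation of `ℂˣ` on `ℂ²` with weights `1` and `n`. -/
def weightRep (n : ℕ) : Representation ℂ ℂˣ (ℂ × ℂ) where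
  toFun g := ((g : ℂ) • LinearMap.id).prodMap (((g : ℂ) ^ n) • LinearMap.id)
  map_one' := by ext <;> simp
  map_mul' g h := by ext <;> simp [mul_pow]

theorem weightRep_apply (n : ℕ) (g : ℂˣ) (z : ℂ × ℂ) :
    weightRep n g z = ((g : ℂ) * z.1, (g : ℂ) ^ n * z.2) := rfl

/-- The space `ℂ² ∖ {0}`, on which `ℂˣ` acts with weights `1` and `n`; the orbifold quotient is the
weighted projective line `ℙ(1, n)`. -/
def Plane (_n : ℕ) : Type := {z : ℂ × ℂ // z ≠ 0}

instance (n : ℕ) : TopologicalSpace (Plane n) :=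
  inferInstanceAs (TopologicalSpace {z : ℂ × ℂ // z ≠ 0})

instance (n : ℕ) : MulAction ℂˣ (Plane n) where
  smul g z := ⟨weightRep n g z.1, fun h => z.2 <| by
    have h' := congrArg (weightRep n g⁻¹) h
    rwa [← Module.End.mul_apply, ← map_mul, inv_mul_cancel, map_one, Module.End.one_apply,
      map_zero] at h'⟩
  one_smul z := Subtype.ext <| by
    change weightRep n 1 z.1 = z.1
    simp
  mul_smul g h z := Subtype.ext <| by
    change weightRep n (g * h) z.1 = weightRep n g (weightRep n h z.1)
    simp

/-- The inertia space `{(g, x) | g x = x}`, with the action `h (g, x) = (h g h⁻¹, h x)`. -/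
def Inertia (n : ℕ) : Type := {a : ℂˣ × Plane n // a.1 • a.2 = a.2}

instance (n : ℕ) : TopologicalSpace (Inertia n) :=
  inferInstanceAs (TopologicalSpace {a : ℂˣ × Plane n // a.1 • a.2 = a.2})

instance (n : ℕ) : MulAction ℂˣ (Inertia n) where
  smul h a := ⟨(h * a.1.1 * h⁻¹, h • a.1.2), by
    change (h * a.1.1 * h⁻¹) • h • a.1.2 = h • a.1.2
    rw [smul_smul, inv_mul_cancel_right, mul_smul, a.2]⟩
  one_smul a := Subtype.ext <| by
    change (1 * a.1.1 * 1⁻¹, (1 : ℂˣ) • a.1.2) = a.1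
    simp
  mul_smul g h a := Subtype.ext <| by
    change (g * h * a.1.1 * (g * h)⁻¹, (g * h) • a.1.2) =
      (g * (h * a.1.1 * h⁻¹) * g⁻¹, g • h • a.1.2)
    rw [mul_smul]; congr 1; group

variable {n : ℕ}

/-- The group element of a point `(g, x)` of the inertia space. -/
def Inertia.elt (a : Inertia n) : ℂˣ := a.1.1

theorem Inertia.elt_smul (h : ℂˣ) (a : Inertia n) : (h • a).elt = a.elt :=
  mul_inv_cancel_comm h a.1.1

theorem Inertia.elt_pow (a : Inertia n) (hn : n ≠ 0) : a.elt ^ n = 1 := by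
  have h : weightRep n a.elt a.1.2.1 = a.1.2.1 := congrArg Subtype.val a.2
  rw [weightRep_apply, Prod.ext_iff] at h
  obtain ⟨h1, h2⟩ := h
  have h0 := a.1.2.2
  by_cases hz : a.1.2.1.1 = 0
  · have hz2 : a.1.2.1.2 ≠ 0 := fun h => h0 (Prod.ext hz h)
    exact Units.ext (by simpa using mul_right_cancel₀ hz2 (h2.trans (one_mul _).symm))
  · have : a.elt = 1 := Units.ext (by simpa using mul_right_cancel₀ hz (h1.trans (one_mul _).symm))
    rw [this, one_pow]

theorem Inertia.isOpen_elt [NeZero n] (g : ℂˣ) : IsOpen {a : Inertia n | a.elt = g} := by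
  have hc : Continuous (Inertia.elt : Inertia n → ℂˣ) :=
    continuous_fst.comp continuous_subtype_val
  have hf : {u : ℂˣ | u ^ n = 1 ∧ u ≠ g}.Finite := by
    refine Set.Finite.subset (s := (rootsOfUnity n ℂ : Set ℂˣ)) ?_ fun u hu => hu.1
    exact Set.finite_coe_iff.1 (inferInstanceAs (Finite (rootsOfUnity n ℂ)))
  have : {a : Inertia n | a.elt = g} = (Inertia.elt ⁻¹' {u : ℂˣ | u ^ n = 1 ∧ u ≠ g})ᶜ := by
    ext a; simp [a.elt_pow (NeZero.ne n)]
  rw [this]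
  exact (hf.isClosed.preimage hc).isOpen_compl

open Classical in
/-- For a representation `V` of `ℂˣ` and invariant subspaces `S g` of `V`, the bundle on the inertia
space with fibre `S g` at `(g, x)`: a subbundle of the trivial bundle with fibre `V`, since `g` is
locally constant. -/
def sectorBundle [NeZero n] {V : Type} [AddCommGroup V] [Module ℂ V] [FiniteDimensional ℂ V]
    (ρ : Representation ℂ ℂˣ V) (hρ : ∀ v, WCts (fun g => ρ g v) Set.univ)
    (S : ℂˣ → Submodule ℂ V) (hS : ∀ g h, ∀ v ∈ S g, ρ h v ∈ S g) : EqBundle ℂˣ (Inertia n) where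
  Fib a := S a.elt
  nbhd p := {a | a.elt = p.elt}
  nbhd_open p := Inertia.isOpen_elt p.elt
  mem_nbhd _ := rfl
  triv p a := if h : a.elt = p.elt then Submodule.inclusion (h ▸ le_rfl) else 0
  coord p a := if h : a.elt = p.elt then Submodule.inclusion (h ▸ le_rfl) else 0
  coord_triv p a h v := by
    rw [dif_pos (show a.elt = p.elt from h), dif_pos (show a.elt = p.elt from h)]; rfl
  triv_coord p a h v := by
    rw [dif_pos (show a.elt = p.elt from h), dif_pos (show a.elt = p.elt from h)]; rfl
  act h a a' e := (ρ h).restrict fun v hv => by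
    rw [show a'.elt = a.elt from e ▸ Inertia.elt_smul h a]; exact hS _ _ _ hv
  act_one a e v := Subtype.ext (by
    rw [LinearMap.coe_restrict_apply, map_one, Module.End.one_apply])
  act_mul g h a a' a'' e e' e'' v := Subtype.ext (by
    simp only [LinearMap.coe_restrict_apply, map_mul, Module.End.mul_apply])
  cts p q v := by
    refine WCts.subtype (((hρ (v : V)).comp (u := fun a : ℂˣ × Inertia n => a.1)
      continuousOn_fst fun _ _ => trivial).congr fun a ha => ?_)
    rw [dif_pos (show a.2.elt = p.elt from ha.1), dif_pos (show (a.1 • a.2).elt = q.elt from ha.2)]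
    rfl

/-- `ζ = exp (2πi / n)`. -/
def zeta (n : ℕ) : ℂˣ := Units.mk0 (Complex.exp (2 * Real.pi * Complex.I / n)) (Complex.exp_ne_zero _)

/-- The subspace `ℂ` of `ℂ` if `g = ζᵐ`, and `0` otherwise. -/
def sectorSub (n : ℕ) (m : Fin n) (g : ℂˣ) : Submodule ℂ ℂ where
  carrier := {c | g ≠ zeta n ^ (m : ℕ) → c = 0}
  add_mem' ha hb h := by rw [ha h, hb h, add_zero]
  zero_mem' _ := rfl
  smul_mem' c x hx h := by rw [hx h, smul_zero]

theorem mem_sectorSub {m : Fin n} {g : ℂˣ} {c : ℂ} :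
    c ∈ sectorSub n m g ↔ (g ≠ zeta n ^ (m : ℕ) → c = 0) := Iff.rfl

theorem sectorSub_invariant (n : ℕ) (m : Fin n) (a : ℤ) (g h : ℂˣ) (v : ℂ)
    (hv : v ∈ sectorSub n m g) : charRep a h v ∈ sectorSub n m g := by
  rw [mem_sectorSub] at hv ⊢
  intro hg
  rw [hv hg, map_zero]

/-- The bundle on the inertia space which on the sector `X^m = {(ζᵐ, x) | ζᵐ x = x}` is the line bundle
of the character `g ↦ gᵃ`, and which is zero on the other sectors. -/
def sectorLine [NeZero n] (m : Fin n) (a : ℤ) : EqBundle ℂˣ (Inertia n) :=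
  sectorBundle (charRep a) (charRep_cts a) (sectorSub n m) (sectorSub_invariant n m a)

/-- The class `x_mᵃ` in `K_G(IX) ⊗ ℂ`, supported on the sector `X^m`. For `a = 0` it is the identity
`1_m` of `K_G(X^m) ⊗ ℂ`, for `a = 1` it is `x_m`. -/
def sectorPow [NeZero n] (m : Fin n) (a : ℤ) : KC ℂˣ (Inertia n) := KC.cls (sectorLine m a)

/-- The subspace of `ℂ²` fixed by `g`; it is the tangent space of `{x | g x = x}` at each of its
points. -/
def fixedSub (n : ℕ) (g : ℂˣ) : Submodule ℂ (ℂ × ℂ) := LinearMap.ker (weightRep n g - 1)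

theorem weightRep_dual_cts (n : ℕ) (ℓ : Module.Dual ℂ (ℂ × ℂ)) :
    WCts (fun g => (weightRep n).dual g ℓ) Set.univ := by
  intro L
  let e := Module.evalEquiv ℂ (ℂ × ℂ)
  have h : ∀ g : ℂˣ, L ((weightRep n).dual g ℓ) = ℓ (weightRep n g⁻¹ (e.symm L)) := fun g => by
    conv_lhs => rw [← e.apply_symm_apply L]
    rfl
  simp only [h, weightRep_apply]
  have hc : Continuous ℓ := ℓ.continuous_of_finiteDimensional
  have h1 : Continuous fun g : ℂˣ => ((g⁻¹ : ℂˣ) : ℂ) := Units.continuous_val.comp continuous_inv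
  exact (hc.comp (by fun_prop)).continuousOn

/-- The dual `N*` of the normal bundle `N` of the projection `IX → X`: the fibre at `(g, x)` is the annihilator,
in the dual of the tangent space `ℂ²` of `X` at `x`, of the tangent space of the fixed locus of `g`. It
has rank `0` on the untwisted sector and rank `1` on the twisted ones. -/
def conormal (n : ℕ) [NeZero n] : EqBundle ℂˣ (Inertia n) :=
  sectorBundle (weightRep n).dual (weightRep_dual_cts n) (fun g => (fixedSub n g).dualAnnihilator)
    fun g h ℓ hℓ => by
      rw [Submodule.mem_dualAnnihilator] at hℓ ⊢
      intro v hv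
      refine hℓ _ ?_
      simp only [fixedSub, LinearMap.mem_ker, LinearMap.sub_apply, Module.End.one_apply,
        sub_eq_zero] at hv ⊢
      rw [← Module.End.mul_apply, ← map_mul, mul_comm, map_mul, Module.End.mul_apply]
      rw [hv]

/-- The virtual Adams operations `ψ̃ᵏ(F) = ψᵏ(F) · θᵏ(N*)` on `K_G(IX) ⊗ ℂ`, where the product is the
usual one. -/
def virtualAdams (n : ℕ) [NeZero n] (k : ℕ) : KC ℂˣ (Inertia n) →ₗ[ℂ] KC ℂˣ (Inertia n) :=
  LinearMap.mulRight ℂ (KC.bott k (KC.cls (conormal n))) ∘ₗ KC.adams k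

open LaurentPolynomial

/-- The maximal ideal `⟨x - ζˡ⟩` of `R(ℂˣ) ⊗ ℂ = ℂ[x, x⁻¹]`, of characters vanishing at `ζˡ`. -/
def maxIdeal (n : ℕ) (l : Fin n) : Ideal ℂ[T;T⁻¹] :=
  RingHom.ker (LaurentPolynomial.eval₂ (RingHom.id ℂ) (zeta n ^ (l : ℕ)))

instance (n : ℕ) (l : Fin n) : (maxIdeal n l).IsPrime := RingHom.ker_isPrime _

/-- The localization of `K_G(IX) ⊗ ℂ`, as an algebra over `ℂ[x, x⁻¹]`, at the prime ideal
`⟨x - ζˡ⟩`. -/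
abbrev Loc (n : ℕ) (l : Fin n) : Type 1 :=
  Localization ((maxIdeal n l).primeCompl.map (KC.fromRep (Inertia n)))

/-- The direct sum of the localizations at `⟨x - ζˡ⟩`, for `l = 0, …, n - 1`. -/
abbrev LocSum (n : ℕ) : Type 1 := ∀ l : Fin n, Loc n l

/-- The map given by the localization maps. -/
def locMap (n : ℕ) : KC ℂˣ (Inertia n) →ₗ[ℂ] LocSum n :=
  LinearMap.pi fun l => (Algebra.linearMap (KC ℂˣ (Inertia n)) (Loc n l)).restrictScalars ℂ

/-- The virtual Adams operations on the direct sum of the localizations, transported by the (bijective)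
localization map. -/
def locAdams (n : ℕ) [NeZero n] (k : ℕ) (u : LocSum n) : LocSum n :=
  locMap n (virtualAdams n k (Function.invFun (locMap n) u))

/-- The generator `1_{ml}`: the image of `1_m` in the `l`-th localization. -/
def gen [NeZero n] (m l : Fin n) : LocSum n := Pi.single l (locMap n (sectorPow m 0) l)

/-- The generator `x_{ml}`: the image of `x_m` in the `l`-th localization. -/
def genX [NeZero n] (m l : Fin n) : LocSum n := Pi.single l (locMap n (sectorPow m 1) l)

/-- The solutions `y` in `{0, …, n - 1}` of `k y ≡ l mod n`. -/
def solutions (n k : ℕ) (l : Fin n) : Finset (Fin n) :=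
  Finset.univ.filter fun y => k * (y : ℕ) ≡ l [MOD n]

end WeightedLine

end VirtualKTheory

end

open VirtualKTheory WeightedLine

/-!
# Virtual Adams operations on the weighted projective line

All the formulas follow from a few relations that hold in `K = K_G(IX) ⊗ ℂ`; neither generators of
`K` nor the independence of the classes are needed. Let `x` be the class of the standard character.

*Relations.* The nowhere vanishing section `(z₁, z₂)` of `L ⊕ Lⁿ` splits this bundle as `1 ⊕ Lⁿ⁺¹`
(`lineBundle_koszul`), so that `(x - 1)(xⁿ - 1) = 0` in `K`. On a twisted sector `z₂` is a nowhere
vanishing section of `Lⁿ`, so that `(xⁿ - 1) 1_m = 0` for `m ≠ 0`. The conormal bundle restricts to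
`x⁻¹` on the twisted sectors and to `0` on the untwisted one.

*Localization.* By the first relation, `K` is a module over `ℂ[x] / (x - 1)(xⁿ - 1)`, hence over
`ℂ[x] / ∏ₗ (x - ζˡ)²`. The partition of unity `1 = ∑ₗ eₗ(x)` of the Chinese remainder theorem
(`exists_partition`) shows that `K` is the sum of its localizations at the `ζˡ`
(`bijective_locMap`), and `eₗ(x) u` corresponds to the component of `u` in the `l`-th of them.
Thus `1_{ml}` corresponds to `eₗ(x) 1_m`.

*Adams operations.* A bundle of rank at most one has `λ_t(E) = 1 + t E`, and therefore `ψᵏ(E) = Eᵏ`.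
By linearity `ψᵏ(p(x) 1_m) = p(xᵏ) 1_m` for every polynomial `p`. Since `(x - ζˢ)²` divides
`(xᵏ - ζᵏˢ)²`, the image of `eₗ(xᵏ)` in the `s`-th localization is `1` if `k s ≡ l` and `0` otherwise
(`algebraMap_aeval_pow_partition`). It remains to evaluate the Bott class, a geometric sum in `ζ⁻ˢ`
on the twisted sectors, and `xᵏ` modulo `(x - 1)²`.
-/

noncomputable section

namespace VirtualKTheory

/-! ### Adams operations on bundles of rank at most one -/

section RankOne

variable {G Y : Type} [Group G] [TopologicalSpace G] [TopologicalSpace Y] [MulAction G Y]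

theorem EqBundle.ext_one (E : EqBundle G Y) : Iso (E.ext 1) E :=
  .ofNatural (fun y => exteriorPower.oneEquiv ℂ (E.Fib y))
    (fun _ _ _ _ v => LinearMap.congr_fun (exteriorPower.oneEquiv_naturality _) v)
    (fun _ => rfl)
    (fun _ _ v => LinearMap.congr_fun (exteriorPower.oneEquiv_naturality _) v)

theorem EqBundle.ext_iso_zero (E : EqBundle G Y) (h : ∀ y, Module.finrank ℂ (E.Fib y) ≤ 1)
    {i : ℕ} (hi : 2 ≤ i) : Iso (E.ext i) zero :=
  iso_zero _ fun y => by
    change Subsingleton (⋀[ℂ]^i (E.Fib y))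
    refine (Module.finrank_zero_iff (R := ℂ)).1 ?_
    rw [exteriorPower.finrank_eq]
    exact Nat.choose_eq_zero_of_lt ((h y).trans_lt hi)

open PowerSeries in
theorem KTh.lamSeries_of_rank_le_one (E : EqBundle G Y)
    (h : ∀ y, Module.finrank ℂ (E.Fib y) ≤ 1) :
    lamSeries (VectClass.mk E) = 1 + C (cls E) * X := by
  ext i
  rw [lamSeries, coeff_mk]
  match i with
  | 0 => simp [VectClass.lam_zero]
  | 1 =>
    rw [map_add, coeff_one, if_neg one_ne_zero, zero_add, coeff_C_mul, coeff_one_X, mul_one]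
    exact congrArg ofClass (Quotient.sound (EqBundle.ext_one E))
  | i + 2 =>
    rw [map_add, coeff_one, if_neg (by omega), zero_add, coeff_C_mul, coeff_X, if_neg (by omega),
      mul_zero, ← map_zero ofClass]
    exact congrArg ofClass (Quotient.sound (EqBundle.ext_iso_zero E h (by omega)))

open PowerSeries in
/-- For a bundle of rank at most one `λ_t(E) = 1 + t E`, whose logarithmic derivative is the
geometric series `tE / (1 + tE)`. -/
theorem KTh.adams_cls_of_rank_le_one (E : EqBundle G Y)
    (h : ∀ y, Module.finrank ℂ (E.Fib y) ≤ 1) {k : ℕ} (hk : 1 ≤ k) :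
    adams k (cls E) = cls E ^ k := by
  obtain ⟨k, rfl⟩ : ∃ j, k = j + 1 := ⟨k - 1, by omega⟩
  set e := cls E with he
  have hgeom : (1 + C e * X) * PowerSeries.mk (fun i => (-e) ^ i) = 1 := by
    ext i
    rw [add_mul, one_mul, mul_assoc, map_add, coeff_C_mul]
    cases i with
    | zero => simp
    | succ i =>
      rw [coeff_succ_X_mul, coeff_mk, coeff_mk, coeff_one, if_neg (by omega)]
      ring
  have hinv : invOfUnit (1 + C e * X) 1 = PowerSeries.mk (fun i => (-e) ^ i) := by
    have h1 := mul_invOfUnit (1 + C e * X) 1 (by simp)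
    calc _ = ((1 + C e * X) * PowerSeries.mk (fun i => (-e) ^ i)) *
          invOfUnit (1 + C e * X) 1 := by rw [hgeom, one_mul]
      _ = ((1 + C e * X) * invOfUnit (1 + C e * X) 1) *
          PowerSeries.mk (fun i => (-e) ^ i) := by ring
      _ = _ := by rw [h1, one_mul]
  have hd : derivative (KTh G Y) (1 + C e * X) = C e := by
    rw [map_add, Derivation.leibniz, derivative_X, derivative_C]
    simp
  rw [adams, he, cls, lift_ofClass]
  change (-1) ^ (k + 1 - 1) * coeff (k + 1) (logDer (lamSeries (VectClass.mk E))) = _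
  rw [lamSeries_of_rank_le_one E h, ← he, logDer, hinv, hd, mul_assoc, coeff_succ_X_mul,
    coeff_C_mul, coeff_mk, Nat.add_sub_cancel, neg_pow]
  have : ((-1 : KTh G Y) ^ k) * (-1) ^ k = 1 := by
    rw [← mul_pow, neg_one_mul, neg_neg, one_pow]
  change _ = e ^ (k + 1)
  linear_combination (e ^ (k + 1)) * this

theorem KC.cls_eq_of_iso {E F : EqBundle G Y} (h : EqBundle.Iso E F) : KC.cls E = KC.cls F :=
  congrArg (fun a => KC.ofK (KTh.ofClass a)) (Quotient.sound h)

theorem KC.cls_tensor (E F : EqBundle G Y) : KC.cls (E.tensor F) = KC.cls E * KC.cls F := by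
  rw [KC.cls, KC.cls, KC.cls, KTh.cls, KTh.cls, KTh.cls, ← map_mul, ← map_mul]; rfl

theorem KC.cls_sum (E F : EqBundle G Y) : KC.cls (E.sum F) = KC.cls E + KC.cls F := by
  rw [KC.cls, KC.cls, KC.cls, KTh.cls, KTh.cls, KTh.cls, ← map_add, ← map_add]; rfl

theorem KC.cls_zero : KC.cls (EqBundle.zero : EqBundle G Y) = 0 := by
  rw [← map_zero KC.ofK, ← map_zero KTh.ofClass]; rfl

theorem KC.cls_unit : KC.cls (EqBundle.unit : EqBundle G Y) = 1 := by
  rw [← map_one KC.ofK, ← map_one KTh.ofClass]; rfl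

theorem KC.adams_cls_of_rank_le_one (E : EqBundle G Y)
    (h : ∀ y, Module.finrank ℂ (E.Fib y) ≤ 1) {k : ℕ} (hk : 1 ≤ k) :
    KC.adams k (KC.cls E) = KC.cls E ^ k := by
  rw [KC.cls, ← map_pow, ← KTh.adams_cls_of_rank_le_one E h hk]
  rfl

end RankOne

theorem WCts.of_continuousOn {T : Type} [TopologicalSpace T] {f : T → ℂ} {S : Set T}
    (hf : ContinuousOn f S) : WCts f S :=
  (WCts.smul hf (WCts.const (1 : ℂ))).congr fun t _ => by simp

namespace WeightedLine

section

variable {n : ℕ}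

/-! ### Line bundles on the sectors -/

theorem sectorSub_self (m : Fin n) : sectorSub n m (zeta n ^ (m : ℕ)) = ⊤ :=
  eq_top_iff.2 fun _ _ h => absurd rfl h

theorem sectorSub_of_ne {m : Fin n} {g : ℂˣ} (h : g ≠ zeta n ^ (m : ℕ)) : sectorSub n m g = ⊥ :=
  eq_bot_iff.2 fun _ hc => hc h

theorem fixedSub_one : fixedSub n 1 = ⊤ := by
  rw [fixedSub, map_one, sub_self, LinearMap.ker_zero]

theorem mem_fixedSub_of_ne_one {g : ℂˣ} (hg : g ≠ 1) (hgn : g ^ n = 1) (z : ℂ × ℂ) :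
    z ∈ fixedSub n g ↔ z.1 = 0 := by
  have h1 : (g : ℂ) ≠ 1 := fun h => hg (Units.ext h)
  have h2 : (g : ℂ) ^ n = 1 := by rw [← Units.val_pow_eq_pow_val, hgn, Units.val_one]
  rw [fixedSub, LinearMap.mem_ker, LinearMap.sub_apply, Module.End.one_apply, weightRep_apply, h2,
    one_mul, sub_eq_zero, Prod.ext_iff, and_iff_left rfl]
  constructor
  · intro h
    have h : (g : ℂ) * z.1 = z.1 := h
    by_contra h0
    exact h1 (mul_right_cancel₀ h0 (h.trans (one_mul _).symm))
  · intro h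
    change (g : ℂ) * z.1 = z.1
    rw [h, mul_zero]

theorem zeta_pow_self (n : ℕ) [NeZero n] : zeta n ^ n = 1 :=
  Units.ext (by
    rw [Units.val_pow_eq_pow_val, Units.val_one]
    exact (Complex.isPrimitiveRoot_exp n (NeZero.ne n)).pow_eq_one)

theorem isPrimitiveRoot_zeta (n : ℕ) [NeZero n] : IsPrimitiveRoot (zeta n) n :=
  IsPrimitiveRoot.coe_units_iff.1 (Complex.isPrimitiveRoot_exp n (NeZero.ne n))

theorem zeta_pow_ne_one [NeZero n] {m : Fin n} (hm : m ≠ 0) : zeta n ^ (m : ℕ) ≠ 1 :=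
  (isPrimitiveRoot_zeta n).pow_ne_one_of_pos_of_lt (fun h => hm (Fin.ext h)) m.2

theorem zeta_pow_injective [NeZero n] {l m : Fin n} (h : zeta n ^ (l : ℕ) = zeta n ^ (m : ℕ)) :
    l = m :=
  Fin.ext ((isPrimitiveRoot_zeta n).pow_inj l.2 m.2 h)

variable [NeZero n]

theorem finrank_sectorLine_le_one (m : Fin n) (a : ℤ) (y : Inertia n) :
    Module.finrank ℂ ((sectorLine m a).Fib y) ≤ 1 :=
  (Submodule.finrank_le (sectorSub n m y.elt)).trans (Module.finrank_self ℂ).le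

theorem lineBundle_tensor_sectorLine (a b : ℤ) (m : Fin n) :
    EqBundle.Iso ((KTh.lineBundle a).tensor (sectorLine m b)) (sectorLine m (a + b)) := by
  refine .ofNatural (fun y => TensorProduct.lid ℂ (sectorSub n m y.elt)) (fun g y y' h v => ?_)
    (fun _ => Set.univ_inter _) (fun p y v => ?_)
  · let f : sectorSub n m y.elt →ₗ[ℂ] sectorSub n m y'.elt := (sectorLine m b).act g y y' h
    let f' : sectorSub n m y.elt →ₗ[ℂ] sectorSub n m y'.elt := (sectorLine m (a + b)).act g y y' h
    refine LinearMap.congr_fun (TensorProduct.ext'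
      (g := (TensorProduct.lid ℂ (sectorSub n m y'.elt)).toLinearMap ∘ₗ
        TensorProduct.map (charRep a g) f)
      (h := f' ∘ₗ (TensorProduct.lid ℂ (sectorSub n m y.elt)).toLinearMap)
      fun c d => Subtype.ext ?_) v
    change (charRep a g c) * (charRep b g d) = charRep (a + b) g (c * d)
    simp only [charRep_apply, zpow_add, Units.val_mul]
    ring
  · let f : sectorSub n m p.elt →ₗ[ℂ] sectorSub n m y.elt := (sectorLine m b).triv p y
    refine LinearMap.congr_fun (TensorProduct.ext'
      (g := (TensorProduct.lid ℂ (sectorSub n m y.elt)).toLinearMap ∘ₗ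
        TensorProduct.map LinearMap.id f)
      (h := f ∘ₗ (TensorProduct.lid ℂ (sectorSub n m p.elt)).toLinearMap)
      fun c d => ?_) v
    exact (f.map_smul c d).symm

/-- Let the linear form `L` have weight `a` and map the fibre of a bundle `E` over the sector `X^m`
bijectively to `ℂ`. Then `L` identifies the restriction of `E` to this sector with the line bundle
of the character `g ↦ gᵃ`. -/
theorem sectorBundle_tensor_sectorLine {V : Type} [AddCommGroup V] [Module ℂ V]
    [FiniteDimensional ℂ V] (ρ : Representation ℂ ℂˣ V)
    (hρ : ∀ v, WCts (fun g => ρ g v) Set.univ)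
    (S : ℂˣ → Submodule ℂ V) (hS : ∀ g h, ∀ v ∈ S g, ρ h v ∈ S g) (L : V →ₗ[ℂ] ℂ) (a b : ℤ)
    (m : Fin n) (hL : ∀ g v, L (ρ g v) = charRep a g (L v))
    (hbij : Function.Bijective (L.domRestrict (S (zeta n ^ (m : ℕ))))) :
    EqBundle.Iso ((sectorBundle ρ hρ S hS).tensor (sectorLine m b)) (sectorLine m (a + b)) := by
  have hmem : ∀ (g : ℂˣ) (v : S g) (c : sectorSub n m g), (c : ℂ) * L v ∈ sectorSub n m g :=
    fun g v c h => by rw [c.2 h, zero_mul]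
  let T : ∀ g : ℂˣ, S g ⊗[ℂ] sectorSub n m g →ₗ[ℂ] sectorSub n m g := fun g =>
    TensorProduct.lift (LinearMap.mk₂ ℂ (fun v c => ⟨(c : ℂ) * L v, hmem g v c⟩)
      (fun u v c => Subtype.ext (by simp [mul_add])) (fun c v d => Subtype.ext (by simp; ring))
      (fun v c d => Subtype.ext (by simp [add_mul])) (fun c v d => Subtype.ext (by simp; ring)))
  have hT : ∀ g v c, (T g (v ⊗ₜ c) : ℂ) = (c : ℂ) * L v := fun _ _ _ => rfl
  have hTb : ∀ g, Function.Bijective (T g) := by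
    intro g
    by_cases hg : g = zeta n ^ (m : ℕ)
    · subst hg
      have e := LinearEquiv.ofBijective _ hbij
      have hs : Function.Surjective (T (zeta n ^ (m : ℕ))) := by
        intro c
        obtain ⟨v, hv⟩ := hbij.2 1
        refine ⟨v ⊗ₜ c, Subtype.ext ?_⟩
        rw [hT]
        change L v = 1 at hv
        rw [hv, mul_one]
      refine ⟨?_, hs⟩
      have hd : Module.finrank ℂ (S (zeta n ^ (m : ℕ)) ⊗[ℂ] sectorSub n m (zeta n ^ (m : ℕ))) =
          Module.finrank ℂ (sectorSub n m (zeta n ^ (m : ℕ))) := by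
        rw [Module.finrank_tensorProduct, e.finrank_eq, Module.finrank_self, one_mul]
      exact (LinearMap.injective_iff_surjective_of_finrank_eq_finrank hd).2 hs
    · have h1 : Subsingleton (sectorSub n m g) := by
        rw [sectorSub_of_ne hg]; infer_instance
      have h2 : Subsingleton (S g ⊗[ℂ] sectorSub n m g) :=
        ⟨fun x y => by
          have h0 : ∀ z : S g ⊗[ℂ] sectorSub n m g, z = 0 := fun z => by
            induction z with
            | zero => rfl
            | add u v hu hv => rw [hu, hv, add_zero]
            | tmul u v => rw [Subsingleton.elim v 0, TensorProduct.tmul_zero]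
          rw [h0 x, h0 y]⟩
      exact ⟨fun x y _ => Subsingleton.elim x y, fun x => ⟨0, Subsingleton.elim _ x⟩⟩
  refine .ofNatural (fun y => LinearEquiv.ofBijective (T y.elt) (hTb y.elt)) (fun g y y' h v => ?_)
    (fun p => Set.inter_self _) (fun p y v => ?_)
  · let e : S y.elt →ₗ[ℂ] S y'.elt := (sectorBundle ρ hρ S hS).act g y y' h
    let f : sectorSub n m y.elt →ₗ[ℂ] sectorSub n m y'.elt := (sectorLine m b).act g y y' h
    let f' : sectorSub n m y.elt →ₗ[ℂ] sectorSub n m y'.elt := (sectorLine m (a + b)).act g y y' h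
    refine LinearMap.congr_fun (TensorProduct.ext' (g := T y'.elt ∘ₗ TensorProduct.map e f)
      (h := f' ∘ₗ T y.elt) fun u c => Subtype.ext ?_) v
    change charRep b g c * L (ρ g u) = charRep (a + b) g (c * L u)
    rw [hL]
    simp only [charRep_apply, zpow_add, Units.val_mul]
    ring
  · let e : S p.elt →ₗ[ℂ] S y.elt := (sectorBundle ρ hρ S hS).triv p y
    let f : sectorSub n m p.elt →ₗ[ℂ] sectorSub n m y.elt := (sectorLine m b).triv p y
    have he : ∀ u : S p.elt, y.elt = p.elt → (e u : V) = u := fun u h => by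
      simp only [e, sectorBundle, dif_pos h]; rfl
    have hf : ∀ u : sectorSub n m p.elt, y.elt = p.elt → (f u : ℂ) = u := fun u h => by
      simp only [f, sectorLine, sectorBundle, dif_pos h]; rfl
    have hf0 : y.elt ≠ p.elt → f = 0 := fun h => by
      simp only [f, sectorLine, sectorBundle, dif_neg h]
    refine LinearMap.congr_fun (TensorProduct.ext' (g := T y.elt ∘ₗ TensorProduct.map e f)
      (h := f ∘ₗ T p.elt) fun u c => ?_) v
    rw [LinearMap.comp_apply, LinearMap.comp_apply, TensorProduct.map_tmul]
    by_cases h : y.elt = p.elt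
    · refine Subtype.ext ?_
      rw [hT, hf _ h, hf _ h, he _ h, hT]
    · rw [hf0 h, LinearMap.zero_apply, LinearMap.zero_apply, TensorProduct.tmul_zero, map_zero]

theorem sectorLine_tensor_self (m : Fin n) (a b : ℤ) :
    EqBundle.Iso ((sectorLine m a).tensor (sectorLine m b)) (sectorLine m (a + b)) := by
  refine sectorBundle_tensor_sectorLine _ _ _ _ LinearMap.id a b m (fun _ _ => rfl) ?_
  rw [sectorSub_self]
  exact ⟨Subtype.val_injective, fun c => ⟨⟨c, trivial⟩, rfl⟩⟩

/-- On a twisted sector the conormal bundle is the dual of the first coordinate line. -/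
theorem conormal_tensor_sectorLine {m : Fin n} (hm : m ≠ 0) (b : ℤ) :
    EqBundle.Iso ((conormal n).tensor (sectorLine m b)) (sectorLine m (-1 + b)) := by
  have hmem := mem_fixedSub_of_ne_one (zeta_pow_ne_one hm)
    (by rw [← pow_mul, mul_comm, pow_mul, zeta_pow_self, one_pow])
  refine sectorBundle_tensor_sectorLine _ _ _ _ (LinearMap.applyₗ ((1, 0) : ℂ × ℂ)) (-1) b m
    (fun g ℓ => ?_) ⟨?_, fun c => ?_⟩
  · change ℓ (weightRep n g⁻¹ (1, 0)) = ((g ^ (-1 : ℤ) : ℂˣ) : ℂ) * ℓ (1, 0)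
    rw [weightRep_apply, zpow_neg_one, ← smul_eq_mul ((g⁻¹ : ℂˣ) : ℂ) (ℓ (1, 0)), ← map_smul]
    simp
  · refine (injective_iff_map_eq_zero _).2 fun ℓ hℓ => Subtype.ext (LinearMap.ext fun z => ?_)
    have h1 : (ℓ : Module.Dual ℂ (ℂ × ℂ)) (1, 0) = 0 := hℓ
    have h2 : (ℓ : Module.Dual ℂ (ℂ × ℂ)) (0, 1) = 0 :=
      (Submodule.mem_dualAnnihilator _).1 ℓ.2 _ ((hmem _).2 rfl)
    have hz : z = z.1 • ((1, 0) : ℂ × ℂ) + z.2 • ((0, 1) : ℂ × ℂ) := by ext <;> simp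
    rw [hz, map_add, map_smul, map_smul, h1, h2]
    simp
  · refine ⟨⟨c • LinearMap.fst ℂ ℂ ℂ, (Submodule.mem_dualAnnihilator _).2 fun z hz => ?_⟩, ?_⟩
    · have := (hmem _).1 hz
      simp [this]
    · change c * 1 = c
      rw [mul_one]

theorem conormal_tensor_sectorLine_zero (b : ℤ) :
    EqBundle.Iso ((conormal n).tensor (sectorLine 0 b)) EqBundle.zero := by
  refine EqBundle.iso_zero _ fun y => ?_
  change Subsingleton ((fixedSub n y.elt).dualAnnihilator ⊗[ℂ] sectorSub n 0 y.elt)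
  refine (Module.finrank_zero_iff (R := ℂ)).1 ?_
  rw [Module.finrank_tensorProduct]
  by_cases h : y.elt = 1
  · rw [h, fixedSub_one, Submodule.dualAnnihilator_top, finrank_bot, zero_mul]
  · rw [sectorSub_of_ne (by simpa using h), finrank_bot, mul_zero]

/-- On the twisted sector `X^m` the second coordinate is a nowhere vanishing section of the line
bundle of the character `g ↦ gⁿ`. -/
theorem sectorLine_iso_of_ne_zero {m : Fin n} (hm : m ≠ 0) :
    EqBundle.Iso (sectorLine m 0) (sectorLine m n) := by
  have hz : ∀ y : Inertia n, y.elt = zeta n ^ (m : ℕ) → y.1.2.1.2 ≠ 0 := by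
    intro y hy h0
    have h1 : y.1.2.1 ∈ fixedSub n y.elt := by
      rw [fixedSub, LinearMap.mem_ker, LinearMap.sub_apply, sub_eq_zero]
      exact congrArg Subtype.val y.2
    rw [mem_fixedSub_of_ne_one (hy ▸ zeta_pow_ne_one hm) (y.elt_pow (NeZero.ne n))] at h1
    exact y.1.2.2 (Prod.ext h1 h0)
  have hc : Continuous fun y : Inertia n => y.1.2.1.2 :=
    continuous_snd.comp (continuous_subtype_val.comp (continuous_snd.comp continuous_subtype_val))
  have hz' : ∀ (g : ℂˣ) (y : Inertia n), (g • y).1.2.1.2 = (g : ℂ) ^ n * y.1.2.1.2 :=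
    fun _ _ => rfl
  -- scalar multiplication by a function that is continuous on the sector and has weight `b - a`
  have key : ∀ (a b : ℤ) (f : Inertia n → ℂ),
      ContinuousOn f {y | y.elt = zeta n ^ (m : ℕ)} →
      (∀ (g : ℂˣ) y, f (g • y) * ((g ^ a : ℂˣ) : ℂ) = ((g ^ b : ℂˣ) : ℂ) * f y) →
      ∃ c : EqBundle.Hom (sectorLine m a) (sectorLine m b),
        ∀ y (v : (sectorLine m a).Fib y), c.map y v = f y • v := by
    intro a b f hf hg
    refine ⟨⟨fun y => f y • (LinearMap.id : sectorSub n m y.elt →ₗ[ℂ] _), ?_, ?_⟩,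
      fun y v => rfl⟩
    · rintro g y _ rfl v
      change sectorSub n m y.elt at v
      refine Subtype.ext ?_
      change f (g • y) * (((g ^ a : ℂˣ) : ℂ) * v) = ((g ^ b : ℂˣ) : ℂ) * (f y * v)
      rw [← mul_assoc, hg, mul_assoc]
    · intro p q v
      change sectorSub n m p.elt at v
      by_cases hp : p.elt = zeta n ^ (m : ℕ)
      · refine WCts.subtype (P := sectorSub n m q.elt) ?_
        have : WCts (fun y => f y • (v : ℂ)) {y : Inertia n | y.elt = p.elt ∧ y.elt = q.elt} :=
          WCts.smul (hf.mono fun y hy => hy.1.trans hp) (WCts.const _)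
        refine this.congr fun y hy => ?_
        have h1 : y.elt = p.elt := hy.1
        have h2 : y.elt = q.elt := hy.2
        simp only [sectorLine, sectorBundle, dif_pos h1, dif_pos h2]
        rfl
      · have hv : v = 0 := Subtype.ext (v.2 hp)
        refine (WCts.const (0 : sectorSub n m q.elt)).congr fun y _ => ?_
        rw [hv]
        exact (congrArg _ (congrArg _ (map_zero _))).trans
          ((congrArg _ (map_zero _)).trans (map_zero _))
  obtain ⟨c, hc1⟩ := key 0 n (fun y => y.1.2.1.2) hc.continuousOn fun g y => by
    rw [hz', zpow_zero, zpow_natCast, Units.val_one, mul_one, Units.val_pow_eq_pow_val]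
  obtain ⟨d, hd1⟩ := key n 0 (fun y => (y.1.2.1.2)⁻¹) (hc.continuousOn.inv₀ fun y hy => hz y hy)
    fun g y => by
      have : (g : ℂ) ^ n ≠ 0 := pow_ne_zero _ g.ne_zero
      rw [hz', zpow_zero, zpow_natCast, Units.val_one, one_mul, Units.val_pow_eq_pow_val, mul_inv]
      field_simp
  refine ⟨c, d, fun y v => ?_, fun y v => ?_⟩ <;> change sectorSub n m y.elt at v
  · refine (congrArg (d.map y) (hc1 y v)).trans ((hd1 y _).trans (Subtype.ext ?_))
    change (y.1.2.1.2)⁻¹ * (y.1.2.1.2 * v) = v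
    by_cases hy : y.elt = zeta n ^ (m : ℕ)
    · rw [inv_mul_cancel_left₀ (hz y hy)]
    · rw [v.2 hy, mul_zero, mul_zero]
  · refine (congrArg (c.map y) (hd1 y v)).trans ((hc1 y _).trans (Subtype.ext ?_))
    change y.1.2.1.2 * ((y.1.2.1.2)⁻¹ * v) = v
    by_cases hy : y.elt = zeta n ^ (m : ℕ)
    · rw [mul_inv_cancel_left₀ (hz y hy)]
    · rw [v.2 hy, mul_zero, mul_zero]

/-- The Koszul sequence `0 → 1 → L ⊕ Lⁿ → Lⁿ⁺¹ → 0` of the nowhere vanishing section `(z₁, z₂)` of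
`L ⊕ Lⁿ`, split by an equivariant continuous functional that takes the value `1` on this section. -/
theorem lineBundle_koszul (n : ℕ) [NeZero n] :
    EqBundle.Iso ((KTh.lineBundle 1 : EqBundle ℂˣ (Inertia n)).sum (KTh.lineBundle n))
      ((KTh.lineBundle 0).sum (KTh.lineBundle (1 + n))) := by
  let z₁ : Inertia n → ℂ := fun y => y.1.2.1.1
  let z₂ : Inertia n → ℂ := fun y => y.1.2.1.2
  let N : Inertia n → ℂ := fun y => (z₁ y * star (z₁ y)) ^ n + z₂ y * star (z₂ y)
  let α : Inertia n → ℂ := fun y => star (z₁ y) * (z₁ y * star (z₁ y)) ^ (n - 1) / N y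
  let β : Inertia n → ℂ := fun y => star (z₂ y) / N y
  have hN : ∀ y, N y ≠ 0 := by
    intro y h
    have h' : ((‖z₁ y‖ ^ 2) ^ n + ‖z₂ y‖ ^ 2 : ℝ) = 0 := by
      have : (((‖z₁ y‖ ^ 2) ^ n + ‖z₂ y‖ ^ 2 : ℝ) : ℂ) = N y := by
        simp only [N]
        push_cast
        rw [← Complex.mul_conj', ← Complex.mul_conj']
        rfl
      rw [h] at this
      exact_mod_cast this
    have h1 : z₁ y = 0 := by
      have : (‖z₁ y‖ ^ 2) ^ n = 0 := by
        nlinarith [pow_nonneg (sq_nonneg ‖z₁ y‖) n, sq_nonneg ‖z₂ y‖]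
      simpa [NeZero.ne n] using this
    have h2 : z₂ y = 0 := by
      have : ‖z₂ y‖ ^ 2 = 0 := by
        nlinarith [pow_nonneg (sq_nonneg ‖z₁ y‖) n, sq_nonneg ‖z₂ y‖]
      simpa using this
    exact y.1.2.2 (Prod.ext h1 h2)
  have hαβ : ∀ y, α y * z₁ y + β y * z₂ y = 1 := by
    intro y
    have hn : (z₁ y * star (z₁ y)) ^ n =
        (z₁ y * star (z₁ y)) ^ (n - 1) * (z₁ y * star (z₁ y)) := by
      rw [← pow_succ, Nat.sub_add_cancel (NeZero.one_le)]
    have := hN y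
    simp only [α, β]
    field_simp
    simp only [N]
    rw [hn]
    ring
  have h1c : Continuous z₁ :=
    continuous_fst.comp (continuous_subtype_val.comp (continuous_snd.comp continuous_subtype_val))
  have h2c : Continuous z₂ :=
    continuous_snd.comp (continuous_subtype_val.comp (continuous_snd.comp continuous_subtype_val))
  have hNc : Continuous N := by fun_prop
  have hαc : Continuous α := Continuous.div (by fun_prop) hNc hN
  have hβc : Continuous β := Continuous.div (by fun_prop) hNc hN
  have h1g : ∀ (g : ℂˣ) y, z₁ (g • y) = (g : ℂ) * z₁ y := fun _ _ => rfl
  have h2g : ∀ (g : ℂˣ) y, z₂ (g • y) = (g : ℂ) ^ n * z₂ y := fun _ _ => rfl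
  have hNg : ∀ (g : ℂˣ) y, N (g • y) = ((g : ℂ) * star (g : ℂ)) ^ n * N y := by
    intro g y
    simp only [N, h1g, h2g, star_mul', star_pow, mul_pow]
    ring
  have hs : ∀ g : ℂˣ, star (g : ℂ) ≠ 0 := fun g => star_ne_zero.2 g.ne_zero
  have hβg : ∀ (g : ℂˣ) y, β (g • y) * (g : ℂ) ^ n = β y := by
    intro g y
    have h1 := hN y
    have h2 := hs g
    have h3 := g.ne_zero
    simp only [β, hNg, h2g, star_mul', star_pow, mul_pow]
    field_simp
  have hαg : ∀ (g : ℂˣ) y, α (g • y) * (g : ℂ) = α y := by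
    intro g y
    have h1 := hN y
    have h2 := hs g
    have h3 := g.ne_zero
    have h4 : ((g : ℂ) * star (g : ℂ)) ^ n =
        ((g : ℂ) * star (g : ℂ)) ^ (n - 1) * ((g : ℂ) * star (g : ℂ)) := by
      rw [← pow_succ, Nat.sub_add_cancel (NeZero.one_le)]
    simp only [α, hNg, h1g, star_mul', mul_pow, h4]
    field_simp
  -- a homomorphism of sums of two line bundles, as a matrix of continuous functions
  have key : ∀ (a b c d : ℤ) (p q r s : Inertia n → ℂ), Continuous p → Continuous q →
      Continuous r → Continuous s →
      (∀ (g : ℂˣ) y, p (g • y) * ((g ^ a : ℂˣ) : ℂ) = ((g ^ c : ℂˣ) : ℂ) * p y) →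
      (∀ (g : ℂˣ) y, q (g • y) * ((g ^ b : ℂˣ) : ℂ) = ((g ^ c : ℂˣ) : ℂ) * q y) →
      (∀ (g : ℂˣ) y, r (g • y) * ((g ^ a : ℂˣ) : ℂ) = ((g ^ d : ℂˣ) : ℂ) * r y) →
      (∀ (g : ℂˣ) y, s (g • y) * ((g ^ b : ℂˣ) : ℂ) = ((g ^ d : ℂˣ) : ℂ) * s y) →
      ∃ h : EqBundle.Hom ((KTh.lineBundle a : EqBundle ℂˣ (Inertia n)).sum (KTh.lineBundle b))
        ((KTh.lineBundle c).sum (KTh.lineBundle d)),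
        ∀ y (v : ℂ × ℂ), h.map y v = ((p y * v.1 + q y * v.2, r y * v.1 + s y * v.2) : ℂ × ℂ) := by
    intro a b c d p q r s hp hq hr hs hpg hqg hrg hsg
    refine ⟨⟨fun y => LinearMap.prod
      (p y • LinearMap.fst ℂ ℂ ℂ + q y • LinearMap.snd ℂ ℂ ℂ)
      (r y • LinearMap.fst ℂ ℂ ℂ + s y • LinearMap.snd ℂ ℂ ℂ), ?_, ?_⟩, fun _ _ => rfl⟩
    · rintro g y _ rfl ⟨u, v⟩
      change ℂ at u v
      refine Prod.ext ?_ ?_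
      · change p (g • y) * (((g ^ a : ℂˣ) : ℂ) * u) + q (g • y) * (((g ^ b : ℂˣ) : ℂ) * v) =
          ((g ^ c : ℂˣ) : ℂ) * (p y * u + q y * v)
        linear_combination u * hpg g y + v * hqg g y
      · change r (g • y) * (((g ^ a : ℂˣ) : ℂ) * u) + s (g • y) * (((g ^ b : ℂˣ) : ℂ) * v) =
          ((g ^ d : ℂˣ) : ℂ) * (r y * u + s y * v)
        linear_combination u * hrg g y + v * hsg g y
    · rintro _ _ ⟨u, v⟩
      change ℂ at u v
      exact WCts.prodMk (V := ℂ) (W := ℂ)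
        (WCts.of_continuousOn (f := fun y => p y * u + q y * v)
          (Continuous.continuousOn (by fun_prop)))
        (WCts.of_continuousOn (f := fun y => r y * u + s y * v)
          (Continuous.continuousOn (by fun_prop)))
  obtain ⟨f, hf⟩ := key 1 n 0 (1 + n) α β z₂ (fun y => -z₁ y) hαc hβc h2c h1c.neg
    (fun g y => by rw [zpow_one, hαg, zpow_zero, Units.val_one, one_mul])
    (fun g y => by
      rw [zpow_natCast, Units.val_pow_eq_pow_val, hβg, zpow_zero, Units.val_one, one_mul])
    (fun g y => by
      rw [zpow_add, zpow_natCast, zpow_one, Units.val_mul, Units.val_pow_eq_pow_val, h2g]; ring)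
    (fun g y => by
      rw [zpow_add, zpow_natCast, zpow_one, Units.val_mul, Units.val_pow_eq_pow_val, h1g]; ring)
  obtain ⟨f', hf'⟩ := key 0 (1 + n) 1 n z₁ β z₂ (fun y => -α y) h1c hβc h2c hαc.neg
    (fun g y => by rw [zpow_one, zpow_zero, Units.val_one, mul_one, h1g])
    (fun g y => by
      rw [zpow_add, zpow_natCast, zpow_one, Units.val_mul, Units.val_pow_eq_pow_val, ← hβg g y]
      ring)
    (fun g y => by
      rw [zpow_natCast, zpow_zero, Units.val_one, mul_one, Units.val_pow_eq_pow_val, h2g])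
    (fun g y => by
      rw [zpow_add, zpow_natCast, zpow_one, Units.val_mul, Units.val_pow_eq_pow_val, ← hαg g y]
      ring)
  refine ⟨f, f', fun y v => ?_, fun y v => ?_⟩ <;> obtain ⟨u, v⟩ := v <;> change ℂ at u v
  · refine (congrArg (f'.map y) (hf y (u, v))).trans ((hf' y _).trans ?_)
    refine Prod.ext ?_ ?_
    · linear_combination u * hαβ y
    · linear_combination v * hαβ y
  · refine (congrArg (f.map y) (hf' y (u, v))).trans ((hf y _).trans ?_)
    refine Prod.ext ?_ ?_
    · linear_combination u * hαβ y
    · linear_combination v * hαβ y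

end

section

variable {n : ℕ}

/-! ### Relations in the K-theory of the inertia space -/

/-- The class in `K_G(IX) ⊗ ℂ` of the line bundle of the standard character. -/
def charClass (n : ℕ) : KC ℂˣ (Inertia n) := KC.cls (KTh.lineBundle 1)

theorem cls_lineBundle_add (a b : ℤ) :
    (KC.cls (KTh.lineBundle (a + b)) : KC ℂˣ (Inertia n)) =
      KC.cls (KTh.lineBundle a) * KC.cls (KTh.lineBundle b) := by
  rw [← KC.cls_tensor]
  exact (KC.cls_eq_of_iso (KTh.lineBundle_tensor a b)).symm

theorem cls_lineBundle_zero : (KC.cls (KTh.lineBundle 0) : KC ℂˣ (Inertia n)) = 1 := by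
  rw [← KC.cls_unit]
  exact KC.cls_eq_of_iso KTh.lineBundle_zero

theorem cls_lineBundle_natCast (a : ℕ) :
    (KC.cls (KTh.lineBundle (a : ℤ)) : KC ℂˣ (Inertia n)) = charClass n ^ a := by
  induction a with
  | zero => rw [Nat.cast_zero, cls_lineBundle_zero, pow_zero]
  | succ a ih => rw [Nat.cast_succ, cls_lineBundle_add, ih, pow_succ, charClass]

theorem charClass_mul_inv : charClass n * KC.cls (KTh.lineBundle (-1)) = 1 := by
  rw [charClass, ← cls_lineBundle_add, add_neg_cancel, cls_lineBundle_zero]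

open LaurentPolynomial in
theorem fromRep_toLaurent (p : Polynomial ℂ) :
    KC.fromRep (Inertia n) (Polynomial.toLaurent p) = Polynomial.aeval (charClass n) p := by
  have h : ((KC.fromRep (Inertia n)).comp Polynomial.toLaurent) =
      (Polynomial.aeval (charClass n)).toRingHom := by
    apply Polynomial.ringHom_ext
    · intro c
      simp [KC.fromRep]
    · have h1 : KC.fromRep (Inertia n) (Polynomial.toLaurent Polynomial.X) = charClass n := by
        rw [Polynomial.toLaurent_X, KC.fromRep, LaurentPolynomial.eval₂_T, zpow_one]
        rfl
      simpa using h1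
  exact RingHom.congr_fun h p

/-- The vanishing of the Euler class of the nowhere vanishing section `(z₁, z₂)`. -/
theorem koszul_relation (n : ℕ) [NeZero n] : (charClass n - 1) * (charClass n ^ n - 1) = 0 := by
  have h := KC.cls_eq_of_iso (lineBundle_koszul n)
  rw [KC.cls_sum, KC.cls_sum, cls_lineBundle_add, cls_lineBundle_zero, cls_lineBundle_natCast] at h
  change charClass n + _ = 1 + charClass n * _ at h
  linear_combination -h

section

variable [NeZero n]

theorem cls_lineBundle_mul_sectorPow (m : Fin n) (a b : ℤ) :
    KC.cls (KTh.lineBundle a) * sectorPow m b = sectorPow m (a + b) := by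
  rw [sectorPow, ← KC.cls_tensor]
  exact KC.cls_eq_of_iso (lineBundle_tensor_sectorLine a b m)

theorem charClass_pow_mul_sectorPow (m : Fin n) (a : ℕ) (b : ℤ) :
    charClass n ^ a * sectorPow m b = sectorPow m (a + b) := by
  rw [← cls_lineBundle_natCast, cls_lineBundle_mul_sectorPow]

theorem sectorPow_mul_self (m : Fin n) (a b : ℤ) :
    sectorPow m a * sectorPow m b = sectorPow m (a + b) := by
  rw [sectorPow, sectorPow, ← KC.cls_tensor]
  exact KC.cls_eq_of_iso (sectorLine_tensor_self m a b)

theorem sectorPow_pow (m : Fin n) (a : ℤ) {k : ℕ} (hk : 1 ≤ k) :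
    sectorPow m a ^ k = sectorPow m (k * a) := by
  induction k, hk using Nat.le_induction with
  | base => rw [pow_one, Nat.cast_one, one_mul]
  | succ k _ ih => rw [pow_succ, ih, sectorPow_mul_self]; congr 1; push_cast; ring

theorem charClass_pow_sub_one_mul_sectorPow {m : Fin n} (hm : m ≠ 0) :
    (charClass n ^ n - 1) * sectorPow m 0 = 0 := by
  rw [sub_mul, charClass_pow_mul_sectorPow, one_mul, add_zero, sub_eq_zero]
  exact (KC.cls_eq_of_iso (sectorLine_iso_of_ne_zero hm)).symm

/-! ### Virtual Adams operations on the sectors -/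

theorem adams_aeval_mul_sectorPow (m : Fin n) {k : ℕ} (hk : 1 ≤ k) (p : Polynomial ℂ) :
    KC.adams k (Polynomial.aeval (charClass n) p * sectorPow m 0) =
      Polynomial.aeval (charClass n ^ k) p * sectorPow m 0 := by
  induction p using Polynomial.induction_on' with
  | add p q hp hq => rw [map_add, add_mul, map_add, hp, hq, map_add, add_mul]
  | monomial i c =>
    rw [Polynomial.aeval_monomial, Polynomial.aeval_monomial, mul_assoc, mul_assoc,
      charClass_pow_mul_sectorPow, ← pow_mul, charClass_pow_mul_sectorPow, ← Algebra.smul_def,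
      ← Algebra.smul_def, map_smul, sectorPow,
      KC.adams_cls_of_rank_le_one _ (finrank_sectorLine_le_one m _) hk]
    change c • sectorPow m _ ^ k = _
    rw [sectorPow_pow m _ hk]
    push_cast
    rw [add_zero, add_zero]

/-- The conormal bundle has rank `0` on the untwisted sector, so that only the term `1` of its Bott
class remains. -/
theorem bott_conormal_mul_sectorPow_zero {k : ℕ} (hk : 1 ≤ k) :
    KC.bott k (KC.cls (conormal n)) * sectorPow 0 0 = sectorPow 0 0 := by
  have h : KC.cls (conormal n) * sectorPow 0 0 = 0 := by
    rw [sectorPow, ← KC.cls_tensor, KC.cls_eq_of_iso (conormal_tensor_sectorLine_zero 0),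
      KC.cls_zero]
  obtain ⟨k, rfl⟩ : ∃ j, k = j + 1 := ⟨k - 1, by omega⟩
  rw [KC.bott, Finset.sum_range_succ', pow_zero, add_mul, one_mul, Finset.sum_mul,
    Finset.sum_eq_zero, zero_add]
  intro i _
  rw [pow_succ, mul_assoc, h, mul_zero]

theorem bott_conormal_mul_sectorPow {m : Fin n} (hm : m ≠ 0) (k : ℕ) :
    KC.bott k (KC.cls (conormal n)) * sectorPow m 0 =
      KC.bott k (KC.cls (KTh.lineBundle (-1))) * sectorPow m 0 := by
  have h : KC.cls (conormal n) * sectorPow m 0 =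
      KC.cls (KTh.lineBundle (-1)) * sectorPow m 0 := by
    rw [cls_lineBundle_mul_sectorPow, sectorPow, ← KC.cls_tensor]
    exact KC.cls_eq_of_iso (conormal_tensor_sectorLine hm 0)
  rw [KC.bott, KC.bott, Finset.sum_mul, Finset.sum_mul]
  refine Finset.sum_congr rfl fun i hi => ?_
  clear hi
  induction i with
  | zero => rw [pow_zero, pow_zero]
  | succ i ih => rw [pow_succ, mul_assoc, h, mul_left_comm, ih, pow_succ']; ring

theorem virtualAdams_aeval_mul_sectorPow (m : Fin n) {k : ℕ} (hk : 1 ≤ k) (p : Polynomial ℂ) :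
    virtualAdams n k (Polynomial.aeval (charClass n) p * sectorPow m 0) =
      Polynomial.aeval (charClass n ^ k) p *
        (KC.bott k (KC.cls (conormal n)) * sectorPow m 0) := by
  change KC.adams k _ * _ = _
  rw [adams_aeval_mul_sectorPow m hk]
  ring

end

/-! ### The localizations -/

open Polynomial

/-- The complex number `ζˡ`. -/
def zetaPow (l : Fin n) : ℂ := ((zeta n ^ (l : ℕ) : ℂˣ) : ℂ)

theorem zetaPow_injective [NeZero n] : Function.Injective (zetaPow : Fin n → ℂ) :=
  fun _ _ h => zeta_pow_injective (Units.ext h)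

theorem zetaPow_zero [NeZero n] : zetaPow (0 : Fin n) = 1 := by
  simp [zetaPow]

theorem zetaPow_ne_zero (l : Fin n) : zetaPow l ≠ 0 := Units.ne_zero _

theorem zetaPow_pow_self [NeZero n] (l : Fin n) : zetaPow l ^ n = 1 := by
  rw [zetaPow, ← Units.val_pow_eq_pow_val, ← pow_mul, mul_comm, pow_mul, zeta_pow_self, one_pow,
    Units.val_one]

theorem isUnit_algebraMap_aeval (l : Fin n) {p : ℂ[X]}
    (hp : p.eval (zetaPow l) ≠ 0) :
    IsUnit (algebraMap (KC ℂˣ (Inertia n)) (Loc n l) (aeval (charClass n) p)) := by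
  refine IsLocalization.map_units (M := (maxIdeal n l).primeCompl.map (KC.fromRep (Inertia n)))
    (Loc n l) ⟨aeval (charClass n) p, ⟨toLaurent p, fun h => hp ?_, fromRep_toLaurent p⟩⟩
  have h : LaurentPolynomial.eval₂ (RingHom.id ℂ) (zeta n ^ (l : ℕ)) (toLaurent p) = 0 := h
  rwa [LaurentPolynomial.eval₂_toLaurent] at h

/-- An element of `ℂ[x, x⁻¹]` that does not vanish at `ζˡ` is invertible modulo `(x - ζˡ)²`. -/
theorem exists_inverse_mod_sq (l : Fin n) {s : KC ℂˣ (Inertia n)}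
    (hs : s ∈ (maxIdeal n l).primeCompl.map (KC.fromRep (Inertia n))) :
    ∃ a b, a * s + b * aeval (charClass n) ((X - C (zetaPow l)) ^ 2) = 1 := by
  obtain ⟨f, hf, rfl⟩ := hs
  obtain ⟨N, p, hp⟩ := LaurentPolynomial.exists_T_pow f
  have hpz : p.eval (zetaPow l) ≠ 0 := by
    intro h0
    refine hf ?_
    change LaurentPolynomial.eval₂ (RingHom.id ℂ) (zeta n ^ (l : ℕ)) f = 0
    have h1 := congrArg (LaurentPolynomial.eval₂ (RingHom.id ℂ) (zeta n ^ (l : ℕ))) hp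
    rw [LaurentPolynomial.eval₂_toLaurent, map_mul, LaurentPolynomial.eval₂_T] at h1
    exact (Units.mul_left_eq_zero _).1 (h1.symm.trans h0)
  have hco : IsCoprime p ((X - C (zetaPow l)) ^ 2) := by
    refine IsCoprime.pow_right (IsCoprime.symm ?_)
    refine (Irreducible.coprime_iff_not_dvd (irreducible_X_sub_C _)).2 fun h => hpz ?_
    exact dvd_iff_isRoot.1 h
  obtain ⟨a, b, hab⟩ := hco
  have h2 := congrArg (aeval (charClass n)) hab
  rw [map_add, map_mul, map_mul, map_one, ← fromRep_toLaurent p, hp, map_mul] at h2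
  exact ⟨aeval (charClass n) a * KC.fromRep (Inertia n) (LaurentPolynomial.T N),
    aeval (charClass n) b, by linear_combination h2⟩

theorem locMap_apply (u : KC ℂˣ (Inertia n)) (l : Fin n) :
    locMap n u l = algebraMap _ (Loc n l) u := rfl

section

variable [NeZero n]

/-- On elements killed by `xⁿ - 1` the class `x` acts on the `l`-th localization as `ζˡ`, which is a
simple root of `xⁿ - 1`. -/
theorem algebraMap_charClass_mul (l : Fin n) {u : KC ℂˣ (Inertia n)}
    (hu : (charClass n ^ n - 1) * u = 0) :
    algebraMap _ (Loc n l) (charClass n * u) =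
      algebraMap _ (Loc n l) (algebraMap ℂ _ (zetaPow l) * u) := by
  set z : ℂ := zetaPow l with hz
  have hzn : z ^ n = 1 := zetaPow_pow_self l
  -- the cofactor of `x - z` in `xⁿ - 1` takes the value `n zⁿ⁻¹` at `z`
  let q : ℂ[X] := ∑ i ∈ Finset.range n, X ^ i * C z ^ (n - 1 - i)
  have hq : q * (X - C z) = X ^ n - 1 := by
    rw [(Commute.all X (C z)).geom_sum₂_mul, ← C_pow, hzn, C_1]
  have hqz : q.eval z ≠ 0 := by
    have : q.eval z = n * z ^ (n - 1) := by
      simp only [q, eval_finsetSum, eval_mul, eval_pow, eval_X, eval_C]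
      rw [Finset.sum_congr rfl fun i hi => ?_, Finset.sum_const, Finset.card_range,
        nsmul_eq_mul]
      rw [← pow_add]
      congr 1
      have := Finset.mem_range.1 hi
      omega
    rw [this]
    exact mul_ne_zero (Nat.cast_ne_zero.2 (NeZero.ne n)) (pow_ne_zero _ (zetaPow_ne_zero l))
  have h := congrArg (aeval (charClass n)) hq
  simp only [map_mul, map_sub, map_pow, aeval_X, aeval_C, map_one] at h
  rw [← h, mul_assoc] at hu
  have h2 := congrArg (algebraMap _ (Loc n l)) hu
  rw [map_mul, map_zero, (isUnit_algebraMap_aeval l hqz).mul_right_eq_zero, sub_mul, map_sub,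
    sub_eq_zero] at h2
  exact h2

theorem algebraMap_charClass_of_ne_zero {l : Fin n} (hl : l ≠ 0) :
    algebraMap (KC ℂˣ (Inertia n)) (Loc n l) (charClass n) =
      algebraMap (KC ℂˣ (Inertia n)) (Loc n l) (algebraMap ℂ _ (zetaPow l)) := by
  have hu : IsUnit (algebraMap (KC ℂˣ (Inertia n)) (Loc n l)
      (aeval (charClass n) (X - C (1 : ℂ)))) := by
    refine isUnit_algebraMap_aeval l ?_
    rw [eval_sub, eval_X, eval_C, sub_ne_zero]
    exact fun h => hl (zetaPow_injective (h.trans zetaPow_zero.symm))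
  have h := algebraMap_charClass_mul l (u := aeval (charClass n) (X - C (1 : ℂ))) (by
    rw [map_sub, aeval_X, aeval_C, map_one, mul_comm, koszul_relation])
  rw [map_mul, map_mul _ (algebraMap ℂ _ _)] at h
  exact hu.mul_right_cancel h

/-- The exponent `2` is needed for `l = 0` only, where `(x - 1)(xⁿ - 1)` has a double root. -/
theorem algebraMap_sub_sq_eq_zero (l : Fin n) :
    algebraMap _ (Loc n l) (aeval (charClass n)
      ((X - C (zetaPow l)) ^ 2)) = 0 := by
  rw [map_pow, map_sub, aeval_X, aeval_C, map_pow, map_sub]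
  by_cases hl : l = 0
  · subst hl
    have h := algebraMap_charClass_mul (0 : Fin n) (u := charClass n - 1) (by
      rw [mul_comm, koszul_relation])
    rw [← sub_eq_zero, ← map_sub, ← sub_mul] at h
    rw [zetaPow_zero, map_one] at h ⊢
    rw [← map_sub, ← map_pow, pow_two, h]
  · rw [algebraMap_charClass_of_ne_zero hl, sub_self, zero_pow two_ne_zero]

theorem algebraMap_aeval_eq_of_dvd (l : Fin n) {p q : ℂ[X]}
    (h : (X - C (zetaPow l)) ^ 2 ∣ p - q) :
    algebraMap _ (Loc n l) (aeval (charClass n) p) =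
      algebraMap _ (Loc n l) (aeval (charClass n) q) := by
  obtain ⟨r, hr⟩ := h
  rw [← sub_eq_zero, ← map_sub, ← map_sub, hr, map_mul, map_mul, algebraMap_sub_sq_eq_zero,
    zero_mul]

/-! ### The localization map -/

/-- Bezout coefficients split `1` into polynomials `eₗ` that are divisible by `(x - ζʲ)²` for all
`j ≠ l`, so that `eₗ` is congruent to `1` modulo `(x - ζˡ)²`. -/
theorem exists_partition (n : ℕ) [NeZero n] : ∃ e : Fin n → ℂ[X], ∑ l, e l = 1 ∧
    (∀ l j : Fin n, j ≠ l → (X - C (zetaPow j)) ^ 2 ∣ e l) ∧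
    ∀ l : Fin n, (X - C (zetaPow l)) ^ 2 ∣ e l - 1 := by
  classical
  let s : Fin n → ℂ[X] := fun l => (X - C (zetaPow l)) ^ 2
  have hs : Pairwise (Function.onFun IsCoprime s) := by
    intro i j hij
    refine IsCoprime.pow (isCoprime_X_sub_C_of_isUnit_sub (Ne.isUnit ?_))
    exact sub_ne_zero.2 fun h => hij (zetaPow_injective h)
  have hs' : Pairwise (Function.onFun IsCoprime fun i : (Finset.univ : Finset (Fin n)) => s i) :=
    fun i j hij => hs fun h => hij (Subtype.ext h)
  obtain ⟨μ, hμ⟩ := (exists_sum_eq_one_iff_pairwise_coprime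
    (Finset.univ_nonempty (α := Fin n))).2 hs'
  have hd : ∀ l j, j ≠ l → s j ∣ μ l * ∏ i ∈ Finset.univ \ {l}, s i := fun l j hj =>
    Dvd.dvd.mul_left (Finset.dvd_prod_of_mem _ (by simp [hj])) _
  refine ⟨fun l => μ l * ∏ i ∈ Finset.univ \ {l}, s i, hμ, hd, fun l => ?_⟩
  rw [← hμ, ← Finset.add_sum_erase _ _ (Finset.mem_univ l), sub_add_cancel_left, dvd_neg]
  exact Finset.dvd_sum fun j hj => hd j l (Finset.ne_of_mem_erase hj).symm

/-- The elements `eₗ(x)` are the idempotents of the decomposition of `K` into its localizations. -/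
theorem locMap_partition_mul {e : Fin n → ℂ[X]}
    (he : ∀ l j : Fin n, j ≠ l → (X - C (zetaPow j)) ^ 2 ∣ e l)
    (he' : ∀ l : Fin n, (X - C (zetaPow l)) ^ 2 ∣ e l - 1)
    (l : Fin n) (u : KC ℂˣ (Inertia n)) :
    locMap n (aeval (charClass n) (e l) * u) = Pi.single l (locMap n u l) := by
  funext j
  rw [locMap_apply, map_mul]
  by_cases h : j = l
  · subst h
    rw [Pi.single_eq_same, algebraMap_aeval_eq_of_dvd j (he' j), map_one, map_one, one_mul]; rfl
  · rw [Pi.single_eq_of_ne h, algebraMap_aeval_eq_of_dvd j (q := 0) (by simpa using he l j h),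
      map_zero, map_zero, zero_mul]

/-- The polynomial `(x - ζˡ)² eₗ` is divisible by all `(x - ζʲ)²`, hence by `(x - 1)(xⁿ - 1)`. -/
theorem sq_mul_partition_eq_zero {e : Fin n → ℂ[X]}
    (he : ∀ l j : Fin n, j ≠ l → (X - C (zetaPow j)) ^ 2 ∣ e l) (l : Fin n) :
    aeval (charClass n) ((X - C (zetaPow l)) ^ 2) *
      aeval (charClass n) (e l) = 0 := by
  classical
  let s : Fin n → ℂ[X] := fun j => X - C (zetaPow j)
  have hco : Pairwise (Function.onFun IsCoprime s) := fun i j hij =>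
    isCoprime_X_sub_C_of_isUnit_sub
      (Ne.isUnit (sub_ne_zero.2 fun h => hij (zetaPow_injective h)))
  have hdvd : ∀ j, s j ^ 2 ∣ s l ^ 2 * e l := fun j => by
    by_cases h : j = l
    · rw [h]; exact dvd_mul_right _ _
    · exact (he l j h).mul_left _
  have hprod : (∏ j, s j ^ 2) ∣ s l ^ 2 * e l :=
    Finset.prod_dvd_of_coprime (fun i _ j _ hij => (hco hij).pow) fun j _ => hdvd j
  have hroot : X ^ n - 1 = ∏ j, s j := by
    rw [← C_1, X_pow_sub_C_eq_prod (IsPrimitiveRoot.coe_units_iff.2 (isPrimitiveRoot_zeta n))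
      (NeZero.pos n) (one_pow n), Finset.prod_range]
    simp [s, zetaPow]
  obtain ⟨r, hr⟩ : ((X - 1) * (X ^ n - 1) : ℂ[X]) ∣ s l ^ 2 * e l := by
    refine dvd_trans ?_ hprod
    rw [Finset.prod_pow, pow_two]
    refine mul_dvd_mul ?_ hroot.dvd
    refine dvd_trans ?_ (Finset.dvd_prod_of_mem s (Finset.mem_univ 0))
    simp [s, zetaPow_zero]
  rw [← map_mul]
  change aeval (charClass n) (s l ^ 2 * e l) = 0
  rw [hr, map_mul]
  have : aeval (charClass n) ((X - 1) * (X ^ n - 1) : ℂ[X]) = 0 := by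
    simpa using koszul_relation n
  rw [this, zero_mul]

theorem bijective_locMap (n : ℕ) [NeZero n] : Function.Bijective (locMap n) := by
  obtain ⟨e, hsum, he, he'⟩ := exists_partition n
  constructor
  · refine (injective_iff_map_eq_zero _).2 fun u hu => ?_
    have h0 : ∀ l, aeval (charClass n) (e l) * u = 0 := by
      intro l
      obtain ⟨⟨s, hs⟩, hsu⟩ := (IsLocalization.map_eq_zero_iff
        ((maxIdeal n l).primeCompl.map (KC.fromRep (Inertia n))) (Loc n l) u).1 (congrFun hu l)
      obtain ⟨a, b, hab⟩ := exists_inverse_mod_sq l hs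
      have hsu : s * u = 0 := hsu
      have hz := sq_mul_partition_eq_zero he l
      linear_combination (-(aeval (charClass n) (e l) * u)) * hab +
        a * aeval (charClass n) (e l) * hsu + b * u * hz
    have h1 := congrArg (aeval (charClass n)) hsum
    rw [map_one, map_sum] at h1
    rw [← one_mul u, ← h1, Finset.sum_mul]
    exact Finset.sum_eq_zero fun l _ => h0 l
  · intro v
    have h : ∀ l, ∃ u, locMap n u l = v l := by
      intro l
      obtain ⟨⟨r, s, hs⟩, hrs⟩ := IsLocalization.surj
        ((maxIdeal n l).primeCompl.map (KC.fromRep (Inertia n))) (v l)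
      have hrs : v l * algebraMap _ (Loc n l) s = algebraMap _ (Loc n l) r := hrs
      obtain ⟨a, b, hab⟩ := exists_inverse_mod_sq l hs
      refine ⟨r * a, ?_⟩
      have h1 := congrArg (algebraMap _ (Loc n l)) hab
      rw [map_add, map_mul, map_mul, algebraMap_sub_sq_eq_zero, mul_zero, add_zero, map_one] at h1
      rw [locMap_apply, map_mul, ← hrs, mul_assoc, mul_comm (algebraMap _ _ s), h1, mul_one]
    choose u hu using h
    refine ⟨∑ l, aeval (charClass n) (e l) * u l, ?_⟩
    rw [map_sum]
    simp only [locMap_partition_mul he he', hu]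
    exact Finset.univ_sum_single v

end

end

open Polynomial

/-! ### Solutions of the congruence -/

theorem mem_solutions {n k : ℕ} {l s : Fin n} : s ∈ solutions n k l ↔ k * (s : ℕ) ≡ l [MOD n] := by
  simp [solutions]

theorem card_solutions {n : ℕ} [NeZero n] (k : ℕ) (l : Fin n) :
    (solutions n k l).card = if Nat.gcd k n ∣ (l : ℕ) then Nat.gcd k n else 0 := by
  have hn := NeZero.pos n
  have hd : 0 < Nat.gcd k n := Nat.gcd_pos_of_pos_right k hn
  split_ifs with h
  · -- after division by `d = gcd(k, n)`, the coefficient is invertible modulo `n / d`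
    obtain ⟨k', n', hco, hk', hn'⟩ := Nat.exists_coprime k n
    obtain ⟨l', hl'⟩ := h
    set d := Nat.gcd k n
    have hn'0 : 0 < n' := Nat.pos_of_mul_pos_right (hn' ▸ hn)
    obtain ⟨y, -, hy⟩ := Nat.exists_mul_mod_eq_of_coprime l' hco hn'0.ne'
    have hiff : ∀ s : ℕ, k * s ≡ l [MOD n] ↔ s ≡ y [MOD n'] := by
      intro s
      rw [hl', hk', hn', mul_comm n' d, mul_comm k' d, mul_assoc,
        Nat.ModEq.mul_left_cancel_iff' hd.ne']
      exact ⟨fun hs => (hs.trans hy.symm).cancel_left_of_coprime (Nat.coprime_comm.1 hco),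
        fun hs => (hs.mul_left k').trans hy⟩
    rw [solutions, Finset.card_filter]
    simp only [hiff]
    rw [Fin.sum_univ_eq_sum_range (fun s => if s ≡ y [MOD n'] then 1 else 0) n,
      ← Finset.card_filter, ← Nat.count_eq_card_filter_range, Nat.count_modEq_card n hn'0]
    rw [hn', Nat.mul_mod_right, if_neg (Nat.not_lt_zero _), Nat.mul_div_cancel_left _ hn'0,
      add_zero]
  · refine Finset.card_eq_zero.2 (Finset.eq_empty_of_forall_notMem fun s hs => h ?_)
    have hs := mem_solutions.1 hs
    exact (hs.dvd_iff (Nat.gcd_dvd_right k n)).1 ((Nat.gcd_dvd_left k n).mul_right _)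

variable {n : ℕ} [NeZero n]

theorem zetaPow_pow (k : ℕ) (s l : Fin n) (h : s ∈ solutions n k l) :
    zetaPow s ^ k = zetaPow l := by
  rw [zetaPow, zetaPow, ← Units.val_pow_eq_pow_val, ← pow_mul, mul_comm]
  congr 1
  rw [← Nat.mod_add_div (k * s) n, mem_solutions.1 h, pow_add, pow_mul, zeta_pow_self, one_pow,
    mul_one, Nat.mod_eq_of_lt l.2]

/-! ### The virtual Adams operations on the localizations -/

theorem locAdams_locMap (k : ℕ) (u : KC ℂˣ (Inertia n)) :
    locAdams n k (locMap n u) = locMap n (virtualAdams n k u) := by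
  rw [locAdams, Function.leftInverse_invFun (bijective_locMap n).1]

theorem isLinearMap_locAdams (k : ℕ) : IsLinearMap ℂ (locAdams n k) where
  map_add u v := by
    obtain ⟨u, rfl⟩ := (bijective_locMap n).2 u
    obtain ⟨v, rfl⟩ := (bijective_locMap n).2 v
    rw [← map_add, locAdams_locMap, locAdams_locMap, locAdams_locMap, map_add, map_add]
  map_smul c u := by
    obtain ⟨u, rfl⟩ := (bijective_locMap n).2 u
    rw [← map_smul, locAdams_locMap, locAdams_locMap, map_smul, map_smul]

/-- The operation `x ↦ xᵏ` takes the idempotent of the `l`-th localization to the sum of those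
of the `s`-th localizations with `k s ≡ l`. This is seen modulo `(x - ζˢ)²`, which divides
`(xᵏ - ζᵏˢ)²`. -/
theorem algebraMap_aeval_pow_partition {e : Fin n → ℂ[X]}
    (he : ∀ l j : Fin n, j ≠ l → (X - C (zetaPow j)) ^ 2 ∣ e l)
    (he' : ∀ l : Fin n, (X - C (zetaPow l)) ^ 2 ∣ e l - 1) (k : ℕ) (l s : Fin n) :
    algebraMap _ (Loc n s) (aeval (charClass n ^ k) (e l)) =
      if s ∈ solutions n k l then 1 else 0 := by
  have hcomp : ∀ p : ℂ[X], aeval (charClass n ^ k) p = aeval (charClass n) (p.comp (X ^ k)) :=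
    fun p => by rw [aeval_comp, map_pow, aeval_X]
  have hdvd : ∀ (j : Fin n) (p : ℂ[X]), s ∈ solutions n k j → (X - C (zetaPow j)) ^ 2 ∣ p →
      (X - C (zetaPow s)) ^ 2 ∣ p.comp (X ^ k) := by
    rintro j _ hj ⟨q, rfl⟩
    rw [mul_comp, pow_comp, sub_comp, X_comp, C_comp, ← zetaPow_pow k s j hj, C_pow]
    exact (pow_dvd_pow_of_dvd (sub_dvd_pow_sub_pow X (C (zetaPow s)) k) 2).mul_right _
  rw [hcomp]
  split_ifs with h
  · rw [algebraMap_aeval_eq_of_dvd s (q := 1) (by simpa using hdvd l _ h (he' l)), map_one, map_one]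
  · let j : Fin n := ⟨k * s % n, Nat.mod_lt _ (NeZero.pos n)⟩
    have hj : s ∈ solutions n k j := mem_solutions.2 (Nat.mod_modEq _ _).symm
    have hjl : j ≠ l := fun hjl => h (hjl ▸ hj)
    rw [algebraMap_aeval_eq_of_dvd s (q := 0) (by simpa using hdvd j _ hj (he l j hjl)), map_zero,
      map_zero]

theorem locAdams_single_apply (m l s : Fin n) {k : ℕ} (hk : 1 ≤ k) (p : ℂ[X]) :
    locAdams n k (Pi.single l (locMap n (aeval (charClass n) p * sectorPow m 0) l)) s =
      if s ∈ solutions n k l then algebraMap _ (Loc n s) (aeval (charClass n ^ k) p *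
        (KC.bott k (KC.cls (conormal n)) * sectorPow m 0)) else 0 := by
  obtain ⟨e, -, he, he'⟩ := exists_partition n
  -- the preimage of the element under the localization map is `eₗ(x) p(x) 1_m`
  rw [← locMap_partition_mul he he', ← mul_assoc, ← map_mul, locAdams_locMap,
    virtualAdams_aeval_mul_sectorPow m hk, locMap_apply, map_mul (aeval _), mul_assoc, map_mul,
    algebraMap_aeval_pow_partition he he']
  split_ifs <;> simp

theorem locAdams_gen_apply (m l s : Fin n) {k : ℕ} (hk : 1 ≤ k) :
    locAdams n k (gen m l) s =
      if s ∈ solutions n k l then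
        algebraMap _ (Loc n s) (KC.bott k (KC.cls (conormal n)) * sectorPow m 0) else 0 := by
  have h := locAdams_single_apply m l s hk 1
  rwa [map_one, map_one, one_mul, one_mul] at h

theorem sum_smul_gen_apply (m s : Fin n) (S : Finset (Fin n)) (c : Fin n → ℂ) :
    (∑ i ∈ S, c i • gen m i) s =
      if s ∈ S then c s • algebraMap _ (Loc n s) (sectorPow m 0) else 0 := by
  rw [Finset.sum_apply]
  have h : ∀ i ∈ S, i ≠ s → (c i • gen m i) s = 0 := fun i _ hi => by
    rw [Pi.smul_apply, gen, Pi.single_eq_of_ne hi.symm, smul_zero]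
  split_ifs with hs
  · rw [Finset.sum_eq_single_of_mem s hs h, Pi.smul_apply, gen, Pi.single_eq_same]; rfl
  · exact Finset.sum_eq_zero fun i hi => h i hi fun his => hs (his ▸ hi)

theorem sum_gen_apply (m s : Fin n) (S : Finset (Fin n)) :
    (∑ i ∈ S, gen m i) s = if s ∈ S then algebraMap _ (Loc n s) (sectorPow m 0) else 0 := by
  simpa using sum_smul_gen_apply m s S 1

theorem locAdams_gen_zero (l : Fin n) {k : ℕ} (hk : 1 ≤ k) :
    locAdams n k (gen 0 l) = ∑ s ∈ solutions n k l, gen 0 s := by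
  funext s
  rw [locAdams_gen_apply 0 l s hk, sum_gen_apply, bott_conormal_mul_sectorPow_zero hk]

/-- On a twisted sector the Bott class of the conormal line, whose class is `x⁻¹`, acts on the
`s`-th localization as the number `1 + ζ⁻ˢ + ⋯ + ζ^(-(k-1)s)`. -/
theorem algebraMap_bott_conormal_mul {m : Fin n} (hm : m ≠ 0) (s : Fin n) (k : ℕ) :
    algebraMap _ (Loc n s) (KC.bott k (KC.cls (conormal n)) * sectorPow m 0) =
      (∑ i ∈ Finset.range k, (zetaPow s)⁻¹ ^ i) • algebraMap _ (Loc n s) (sectorPow m 0) := by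
  set y : KC ℂˣ (Inertia n) := KC.cls (KTh.lineBundle (-1)) with hy
  have hxy : charClass n * y = 1 := charClass_mul_inv
  have h1 : algebraMap _ (Loc n s) (y * sectorPow m 0) =
      (zetaPow s)⁻¹ • algebraMap _ (Loc n s) (sectorPow m 0) := by
    have h := algebraMap_charClass_mul s (charClass_pow_sub_one_mul_sectorPow hm)
    rw [← Algebra.smul_def, ← locMap_apply, ← locMap_apply, map_smul, Pi.smul_apply, locMap_apply,
      locMap_apply] at h
    rw [eq_inv_smul_iff₀ (zetaPow_ne_zero s), map_mul, ← mul_smul_comm, ← h, ← map_mul, ← mul_assoc,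
      mul_comm y, hxy, one_mul]
  have h2 : ∀ i : ℕ, algebraMap _ (Loc n s) (y ^ i * sectorPow m 0) =
      (zetaPow s)⁻¹ ^ i • algebraMap _ (Loc n s) (sectorPow m 0) := by
    intro i
    induction i with
    | zero => rw [pow_zero, pow_zero, one_mul, one_smul]
    | succ i ih =>
      rw [pow_succ', mul_assoc, mul_left_comm, map_mul, h1, mul_smul_comm, ← map_mul, ih, smul_smul,
        pow_succ']
  rw [bott_conormal_mul_sectorPow hm, KC.bott, Finset.sum_mul, map_sum, Finset.sum_smul]
  exact Finset.sum_congr rfl fun i _ => h2 i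

theorem ne_zero_of_mem_solutions {k : ℕ} {l s : Fin n} (hl : l ≠ 0) (hs : s ∈ solutions n k l) :
    s ≠ 0 := by
  rintro rfl
  have h := zetaPow_pow k 0 l hs
  rw [zetaPow_zero, one_pow] at h
  exact hl (zetaPow_injective (h.symm.trans zetaPow_zero.symm))

theorem geom_sum_zetaPow_inv {k : ℕ} {l s : Fin n} (hs : s ∈ solutions n k l) (hs0 : s ≠ 0) :
    ∑ i ∈ Finset.range k, (zetaPow s)⁻¹ ^ i = ((zetaPow l)⁻¹ - 1) / ((zetaPow s)⁻¹ - 1) := by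
  rw [geom_sum_eq, inv_pow, zetaPow_pow k s l hs]
  rw [Ne, inv_eq_one, ← zetaPow_zero (n := n)]
  exact fun h => hs0 (zetaPow_injective h)

theorem locAdams_gen_of_ne_zero {m l : Fin n} (hm : m ≠ 0) (hl : l ≠ 0) {k : ℕ} (hk : 1 ≤ k) :
    locAdams n k (gen m l) = ∑ s ∈ solutions n k l,
      (((zetaPow l)⁻¹ - 1) / ((zetaPow s)⁻¹ - 1)) • gen m s := by
  funext s
  rw [locAdams_gen_apply m l s hk, sum_smul_gen_apply m s _
    fun s => ((zetaPow l)⁻¹ - 1) / ((zetaPow s)⁻¹ - 1)]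
  split_ifs with hs
  · rw [algebraMap_bott_conormal_mul hm,
      geom_sum_zetaPow_inv hs (ne_zero_of_mem_solutions hl hs)]
  · rfl

theorem zero_mem_solutions (k : ℕ) : (0 : Fin n) ∈ solutions n k 0 :=
  mem_solutions.2 (by simp [Nat.ModEq])

theorem locAdams_gen_at_zero {m : Fin n} (hm : m ≠ 0) {k : ℕ} (hk : 1 ≤ k) :
    locAdams n k (gen m 0) = (k : ℂ) • gen m 0 := by
  funext s
  rw [locAdams_gen_apply m 0 s hk, Pi.smul_apply, gen]
  by_cases h0 : s = 0
  · subst h0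
    rw [if_pos (zero_mem_solutions k), algebraMap_bott_conormal_mul hm, zetaPow_zero,
      Pi.single_eq_same, locMap_apply]
    simp
  · rw [Pi.single_eq_of_ne h0, smul_zero]
    split_ifs with hs
    · rw [algebraMap_bott_conormal_mul hm, geom_sum_zetaPow_inv hs h0, zetaPow_zero]
      simp
    · rfl

theorem locAdams_genX_zero {k : ℕ} (hk : 1 ≤ k) :
    locAdams n k (genX 0 0) = (k : ℂ) • genX 0 0 - ((k : ℂ) - 1) • gen 0 0 +
      ∑ s ∈ (solutions n k 0).erase (0 : Fin n), gen 0 s := by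
  have hx : (sectorPow 0 1 : KC ℂˣ (Inertia n)) = aeval (charClass n) (X : ℂ[X]) * sectorPow 0 0 := by
    have := charClass_pow_mul_sectorPow (0 : Fin n) 1 0
    rw [aeval_X, ← pow_one (charClass n), this]
    rfl
  funext s
  rw [Pi.add_apply, Pi.sub_apply, Pi.smul_apply, Pi.smul_apply, sum_gen_apply, genX, gen, hx,
    locAdams_single_apply 0 0 s hk, bott_conormal_mul_sectorPow_zero hk, aeval_X, aeval_X]
  by_cases h0 : s = 0
  · subst h0
    rw [if_pos (zero_mem_solutions k), if_neg (Finset.notMem_erase _ _), Pi.single_eq_same,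
      Pi.single_eq_same, add_zero]
    -- the linear approximation of `xᵏ` at `1`
    have hdvd : (X - C (zetaPow (0 : Fin n))) ^ 2 ∣
        (X ^ k : ℂ[X]) - (C (k : ℂ) * X - C ((k : ℂ) - 1)) := by
      rw [zetaPow_zero]
      clear hk
      induction k with
      | zero => simp
      | succ k ih =>
        have hstep : (X ^ (k + 1) : ℂ[X]) - (C ((k + 1 : ℕ) : ℂ) * X - C (((k + 1 : ℕ) : ℂ) - 1)) =
            X * (X ^ k - (C (k : ℂ) * X - C ((k : ℂ) - 1))) + C (k : ℂ) * (X - C 1) ^ 2 := by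
          simp only [Nat.cast_succ, C_add, C_sub, C_1]
          ring
        rw [hstep]
        exact dvd_add (ih.mul_left _) (dvd_mul_left _ _)
    have h := algebraMap_aeval_eq_of_dvd (0 : Fin n) hdvd
    have hsmul : ∀ (c : ℂ) u, c • locMap n u 0 = locMap n (algebraMap ℂ _ c * u) 0 := fun c u => by
      rw [← Algebra.smul_def, map_smul, Pi.smul_apply]
    rw [hsmul, hsmul, map_mul, ← aeval_X_pow (R := ℂ), h]
    simp only [locMap_apply, map_sub, map_mul, aeval_X, aeval_C]
    ring
  · rw [Pi.single_eq_of_ne h0, Pi.single_eq_of_ne h0, smul_zero, smul_zero, sub_zero, zero_add]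
    simp only [Finset.mem_erase, ne_eq, h0, not_false_eq_true, true_and]
    split_ifs with hs
    · rw [map_mul, map_pow, algebraMap_charClass_of_ne_zero h0, ← map_pow, ← map_pow,
        zetaPow_pow k s 0 hs, zetaPow_zero, map_one, map_one, one_mul]
    · rfl

end WeightedLine
end VirtualKTheory
end

theorem proposition6p1 (n : ℕ) [NeZero n] (hn : 2 ≤ n) :
    Function.Bijective (locMap n) ∧
    ∀ k : ℕ, 1 ≤ k →
      IsLinearMap ℂ (locAdams n k) ∧
      (∀ l : Fin n, (solutions n k l).card = if Nat.gcd k n ∣ (l : ℕ) then Nat.gcd k n else 0) ∧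
      (∀ l : Fin n, l ≠ 0 → Nat.gcd k n ∣ (l : ℕ) →
        locAdams n k (gen 0 l) = ∑ s ∈ solutions n k l, gen 0 s) ∧
      (∀ l : Fin n, l ≠ 0 → ¬ Nat.gcd k n ∣ (l : ℕ) → locAdams n k (gen 0 l) = 0) ∧
      (∀ m l : Fin n, m ≠ 0 → l ≠ 0 → Nat.gcd k n ∣ (l : ℕ) →
        locAdams n k (gen m l) = ∑ s ∈ solutions n k l,
          (((zeta n : ℂ) ^ (-((l : ℕ) : ℤ)) - 1) / ((zeta n : ℂ) ^ (-((s : ℕ) : ℤ)) - 1)) •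
            gen m s) ∧
      (∀ m l : Fin n, m ≠ 0 → l ≠ 0 → ¬ Nat.gcd k n ∣ (l : ℕ) → locAdams n k (gen m l) = 0) ∧
      (∀ m : Fin n, m ≠ 0 → locAdams n k (gen m 0) = (k : ℂ) • gen m 0) ∧
      locAdams n k (gen 0 0) = ∑ s ∈ solutions n k 0, gen 0 s ∧
      (0 : Fin n) ∈ solutions n k 0 ∧
      locAdams n k (genX 0 0) =
        (k : ℂ) • genX 0 0 - ((k : ℂ) - 1) • gen 0 0 + ∑ s ∈ (solutions n k 0).erase 0, gen 0 s := by
  have hempty : ∀ (k : ℕ) (l : Fin n), ¬ Nat.gcd k n ∣ (l : ℕ) → solutions n k l = ∅ :=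
    fun k l h => Finset.card_eq_zero.1 ((card_solutions k l).trans (if_neg h))
  have hz : ∀ l : Fin n, (zeta n : ℂ) ^ (-((l : ℕ) : ℤ)) = (zetaPow l)⁻¹ := fun l => by
    rw [zpow_neg, zpow_natCast, zetaPow, Units.val_pow_eq_pow_val]
  simp only [hz]
  refine ⟨bijective_locMap n, fun k hk => ⟨isLinearMap_locAdams k, card_solutions k,
    fun l _ _ => locAdams_gen_zero l hk, fun l _ h => ?_,
    fun m l hm hl _ => locAdams_gen_of_ne_zero hm hl hk, fun m l hm hl h => ?_,
    fun m hm => locAdams_gen_at_zero hm hk, locAdams_gen_zero 0 hk, zero_mem_solutions k,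
    locAdams_genX_zero hk⟩⟩
  · rw [locAdams_gen_zero l hk, hempty k l h, Finset.sum_empty]
  · rw [locAdams_gen_of_ne_zero hm hl hk, hempty k l h, Finset.sum_empty]
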